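/- Let $d\ge 1$. For each $j=1,\dots,d$ let $(a_j,b_j)$ be an open interval with $-\infty\le a_j\le 0$ and $1\le b_j\le\infty$, and let $p_j,q_j$ be positive continuous functions on $(a_j,b_j)$ with $p_j/q_j$ strictly increasing. Put $$k_j(x,x')=p_j(x\wedge x')\,q_j(x\vee x'),\qquad k(\mathbf x,\mathbf x')=\prod_{j=1}^d k_j(x_j,x_j'),$$ the latter being a kernel on $\prod_{j=1}^d(a_j,b_j)$. For a kernel $\kappa$ on a set $I$ and $X_0\subseteq I$, let $\mathscr H_\kappa(X_0)$ denote the space of restrictions to $X_0$ of the functions in the reproducing kernel Hilbert space $\mathscr H_\kappa$ of $\kappa$, with norm $\|g\|_{\mathscr H_\kappa(X_0)}=\inf\{\|h\|_{\mathscr H_\kappa}: h\in\mathscr H_\kappa,\ h|_{X_0}=g\}$. Assume that for each $j$ there are constants $c_j,\tilde c_j>0$ such that * every $g\in\mathscr H_{k_j}((0,1))$ is square integrable with a square integrable weak derivative $g'$, and $c_j\int_0^1|g'|^2\,dx\le\|g\|_{\mathscr H_{k_j}((0,1))}^2$; * every continuous $g\in L^2(0,1)$ with weak derivative $g'\in L^2(0,1)$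 lies in $\mathscr H_{k_j}((0,1))$, and $\|g\|_{\mathscr H_{k_j}((0,1))}^2\le\tilde c_j\int_0^1\bigl(|g|^2+|g'|^2\bigr)\,dx$. (Brownian field kernels $\prod_{j}[\theta_j+\gamma_j(x_j\wedge x_j')]$ with $\theta_j,\gamma_j>0$, and Laplace kernels, are examples.) For integers $\tau\ge1$ let $\mathcal X_\tau^{\mathsf{SG}}\subset(0,1)^d$ be the classical sparse grid $$\mathcal X_\tau^{\mathsf{SG}}=\bigcup_{\substack{l_1,\dots,l_d\ge 1\\ l_1+\cdots+l_d\le\tau+d-1}}\ \prod_{j=1}^d\bigl\{i\,2^{-l_j}:1\le i\le 2^{l_j}-1\bigr\}.$$ A truncated sparse grid of size $n$ is a set $\mathcal X_\tau^{\mathsf{SG}}\cup A$, where $\tau\ge1$ satisfies $|\mathcal X_\tau^{\mathsf{SG}}|\le n<|\mathcal X_{\tau+1}^{\mathsf{SG}}|$ and $A\subseteq\mathcal X_{\tau+1}^{\mathsf{SG}}\setminus\mathcal X_\tau^{\mathsf{SG}}$ has $n-|\mathcal X_\tau^{\mathsf{SG}}|$ elements. Then there is a constant $C>0$, depending only on $d$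 and $k$, such that for every integer $n\ge2$, all points $\mathbf x_1,\dots,\mathbf x_n$ that form a truncated sparse grid of size $n$, and every $f\in\mathscr H_k((0,1)^d)$, the function $f$ is square integrable on $(0,1)^d$ and $$\|f\|_2\le C\Bigl((\log n)^{\frac{3(d-1)}2}\,\|f\|_n+n^{-1}(\log n)^{2(d-1)}\,\|f\|_{\mathscr H_k((0,1)^d)}\Bigr),$$ where $\|f\|_2$ is the norm of $L^2((0,1)^d)$ and $\|f\|_n=\bigl(\frac1n\sum_{i=1}^n f(\mathbf x_i)^2\bigr)^{1/2}$ is the empirical semi-norm. -/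

import Mathlib

open MeasureTheory Set
open scoped ENNReal

noncomputable section

namespace SparseGrid

/-! ### Scalar kernels and their reproducing kernel Hilbert spaces -/

/-- A real-valued kernel, seen as an operator-valued kernel in the format of Mathlib's `RKHS`. -/
def scalarKernel {X : Type*} (k : X → X → ℝ) : Matrix X X (ℝ →L[ℝ] ℝ) :=
  Matrix.of fun x y => k x y • ContinuousLinearMap.id ℝ ℝ

/-- Products of kernels `min (r x) (r y)` with positive `r`, rescaled by a function `c`, are
positive semidefinite. -/
theorem posSemidef_scalarKernel_min {X ι : Type*} [Fintype ι] (c : X → ℝ) (r : ι → X → ℝ)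
    (hr : ∀ i x, 0 < r i x) (k : X → X → ℝ)
    (hk : ∀ x y, k x y = c x * c y * ∏ i, min (r i x) (r i y)) :
    (scalarKernel k).PosSemidef := by
  classical
  suffices h : (scalarKernel k).IsHermitian ∧ ∀ vv : X →₀ ℝ,
      0 ≤ RCLike.re (vv.sum fun x w => vv.sum fun x' w' =>
        inner ℝ ((scalarKernel k) x' x w) w') from
    (RKHS.posSemidef_tfae.out 0 2).mpr h
  refine ⟨?_, ?_⟩
  · have hid : ContinuousLinearMap.adjoint (ContinuousLinearMap.id ℝ ℝ) =
        ContinuousLinearMap.id ℝ ℝ :=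
      star_one (R := ℝ →L[ℝ] ℝ)
    ext x y
    simp [scalarKernel, Matrix.conjTranspose_apply, hk, mul_comm, min_comm,
      ContinuousLinearMap.star_eq_adjoint, hid]
  · intro vv
    set A : X → Set (ι → ℝ) := fun x => Set.pi univ fun i => Ioc 0 (r i x) with hA
    have hAm : ∀ x, MeasurableSet (A x) := fun x =>
      MeasurableSet.univ_pi fun i => measurableSet_Ioc
    have hAA : ∀ x y, A x ∩ A y = Set.pi univ fun i => Ioc 0 (min (r i x) (r i y)) := by
      intro x y
      rw [hA]
      simp only [← Set.pi_inter_distrib, Ioc_inter_Ioc, max_self]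
    have hvol : ∀ x y, volume.real (A x ∩ A y) = ∏ i, min (r i x) (r i y) := by
      intro x y
      rw [hAA, Measure.real, Real.volume_pi_Ioc_toReal]
      · simp
      · intro i
        exact (lt_min (hr i x) (hr i y)).le
    have hfin : ∀ x y, volume (A x ∩ A y) ≠ ∞ := by
      intro x y
      rw [hAA, Real.volume_pi_Ioc]
      exact ENNReal.prod_ne_top fun i _ => ENNReal.ofReal_ne_top
    set g : X → (ι → ℝ) → ℝ := fun x => (A x).indicator fun _ => 1 with hg
    have hgg : ∀ x y u, g x u * g y u = (A x ∩ A y).indicator (fun _ => (1 : ℝ)) u := by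
      intro x y u
      by_cases hx : u ∈ A x <;> by_cases hy : u ∈ A y <;> simp [hg, hx, hy]
    have hint : ∀ x y, Integrable (fun u => g x u * g y u) := by
      intro x y
      simp_rw [hgg]
      exact (integrable_indicator_iff ((hAm x).inter (hAm y))).mpr
        (integrableOn_const (hfin x y))
    have hval : ∀ x y, ∫ u, g x u * g y u = ∏ i, min (r i x) (r i y) := by
      intro x y
      simp_rw [hgg]
      rw [integral_indicator ((hAm x).inter (hAm y)), ← hvol]
      simp
    have key : (vv.sum fun x w => vv.sum fun x' w' =>
        inner ℝ ((scalarKernel k) x' x w) w') =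
        ∫ u, (∑ x ∈ vv.support, vv x * c x * g x u) ^ 2 := by
      have h1 : ∀ u, (∑ x ∈ vv.support, vv x * c x * g x u) ^ 2 =
          ∑ x ∈ vv.support, ∑ y ∈ vv.support,
            (vv x * c x * (vv y * c y)) * (g x u * g y u) := by
        intro u
        rw [sq, Finset.sum_mul_sum]
        exact Finset.sum_congr rfl fun x _ => Finset.sum_congr rfl fun y _ => by ring
      simp_rw [h1]
      rw [integral_finsetSum _ fun x _ => integrable_finsetSum _ fun y _ =>
        (hint x y).const_mul _]
      refine Finset.sum_congr rfl fun x _ => ?_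
      rw [integral_finsetSum _ fun y _ => (hint x y).const_mul _]
      refine Finset.sum_congr rfl fun y _ => ?_
      rw [integral_const_mul, hval]
      simp [scalarKernel, hk, min_comm]
      ring
    rw [key]
    exact integral_nonneg fun u => sq_nonneg _

section Restriction

variable {E : Type*} {I : Set E} (K : Matrix I I (ℝ →L[ℝ] ℝ)) [Fact K.PosSemidef]

/-- The elements of the reproducing kernel Hilbert space of `K` (a space of functions on `I`)
that coincide with `g` on `X₀`. -/
def extensions (X₀ : Set E) (g : E → ℝ) : Set (RKHS.OfKernel K) :=
  {h | ∀ x : I, (x : E) ∈ X₀ → h x = g x}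

/-- `g`, as a function on `X₀`, is the restriction to `X₀` of an element of the reproducing kernel
Hilbert space of `K`. -/
def MemRestrict (X₀ : Set E) (g : E → ℝ) : Prop := (extensions K X₀ g).Nonempty

/-- The norm of `g` in the restriction to `X₀` of the reproducing kernel Hilbert space of `K`:
the infimum of the norms of all extensions of `g`. Meaningful if `MemRestrict K X₀ g`. -/
def restrictNorm (X₀ : Set E) (g : E → ℝ) : ℝ := sInf ((fun h => ‖h‖) '' extensions K X₀ g)

end Restriction

/-! ### Tensor Markov kernels -/

/-- The data of a tensor Markov kernel
`k(x, x') = ∏ j, p j (min (x j) (x' j)) * q j (max (x j) (x' j))`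
on the box `∏ j, (a j, b j)`, whose sides may be unbounded. -/
structure TMKernel (d : ℕ) where
  a : Fin d → EReal
  b : Fin d → EReal
  p : Fin d → ℝ → ℝ
  q : Fin d → ℝ → ℝ
  p_pos : ∀ j (x : ℝ), a j < x → x < b j → 0 < p j x
  q_pos : ∀ j (x : ℝ), a j < x → x < b j → 0 < q j x
  strictMono : ∀ j, StrictMonoOn (fun x => p j x / q j x) {x : ℝ | a j < x ∧ x < b j}

namespace TMKernel

variable {d : ℕ} (T : TMKernel d)

/-- The open interval `(a j, b j)`. -/
def side (j : Fin d) : Set ℝ := {x | T.a j < x ∧ x < T.b j}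

/-- The box `∏ j, (a j, b j)`. -/
def box : Set (Fin d → ℝ) := {x | ∀ j, x j ∈ T.side j}

/-- The one-dimensional factor `k_j(x, x') = p j (min x x') * q j (max x x')`. -/
def factor (j : Fin d) (x y : ℝ) : ℝ := T.p j (min x y) * T.q j (max x y)

/-- The factor `k_j` as a kernel on `(a j, b j)`. -/
def kernel₁ (j : Fin d) : Matrix (T.side j) (T.side j) (ℝ →L[ℝ] ℝ) :=
  scalarKernel fun x y => T.factor j x y

/-- The tensor Markov kernel as a kernel on the box. -/
def kernel : Matrix T.box T.box (ℝ →L[ℝ] ℝ) :=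
  scalarKernel fun x y => ∏ j, T.factor j (x.1 j) (y.1 j)

theorem factor_eq (j : Fin d) {x y : ℝ} (hx : x ∈ T.side j) (hy : y ∈ T.side j) :
    T.factor j x y = T.q j x * T.q j y * min (T.p j x / T.q j x) (T.p j y / T.q j y) := by
  have hqx := (T.q_pos j x hx.1 hx.2).ne'
  have hqy := (T.q_pos j y hy.1 hy.2).ne'
  rcases le_total x y with h | h
  · have := (T.strictMono j).monotoneOn hx hy h
    rw [factor, min_eq_left h, max_eq_right h, min_eq_left this]
    field_simp
  · have := (T.strictMono j).monotoneOn hy hx h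
    rw [factor, min_eq_right h, max_eq_left h, min_eq_right this]
    field_simp

instance (j : Fin d) : Fact (T.kernel₁ j).PosSemidef :=
  ⟨posSemidef_scalarKernel_min (ι := Unit) (fun x : T.side j => T.q j x)
    (fun _ (x : T.side j) => T.p j x / T.q j x)
    (fun _ x => div_pos (T.p_pos j x x.2.1 x.2.2) (T.q_pos j x x.2.1 x.2.2)) _
    (fun x y => by simpa using T.factor_eq j x.2 y.2)⟩

instance : Fact T.kernel.PosSemidef :=
  ⟨posSemidef_scalarKernel_min (ι := Fin d) (fun x : T.box => ∏ j, T.q j (x.1 j))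
    (fun j (x : T.box) => T.p j (x.1 j) / T.q j (x.1 j))
    (fun j x => div_pos (T.p_pos j _ (x.2 j).1 (x.2 j).2) (T.q_pos j _ (x.2 j).1 (x.2 j).2)) _
    (fun x y => by
      rw [← Finset.prod_mul_distrib, ← Finset.prod_mul_distrib]
      exact Finset.prod_congr rfl fun j _ => T.factor_eq j (x.2 j) (y.2 j))⟩

end TMKernel

/-! ### The Sobolev space of order one on the unit interval -/

/-- `g` and `g'` are square integrable on `(0, 1)` and `g'` is the weak derivative of `g` there. -/
structure IsH1 (g g' : ℝ → ℝ) : Prop where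
  memLp : MemLp g 2 (volume.restrict (Ioo 0 1))
  memLp_deriv : MemLp g' 2 (volume.restrict (Ioo 0 1))
  weakDeriv : ∀ φ : ℝ → ℝ, ContDiff ℝ (⊤ : ℕ∞) φ → HasCompactSupport φ →
    tsupport φ ⊆ Ioo 0 1 →
    ∫ x in Ioo (0 : ℝ) 1, g x * deriv φ x = -∫ x in Ioo (0 : ℝ) 1, g' x * φ x

/-- The standing regularity of the kernel: each interval `(a j, b j)` contains `(0, 1)`, the
functions `p j` and `q j` are continuous on it, and the restriction to `(0, 1)` of the reproducing
kernel Hilbert space of the factor `k_j` is the Sobolev space of order one (in its continuous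
representatives), with comparable norms. -/
structure TMKernel.Regular {d : ℕ} (T : TMKernel d) : Prop where
  a_le : ∀ j, T.a j ≤ 0
  le_b : ∀ j, 1 ≤ T.b j
  continuous_p : ∀ j, ContinuousOn (T.p j) (T.side j)
  continuous_q : ∀ j, ContinuousOn (T.q j) (T.side j)
  lower : ∀ j, ∃ c : ℝ, 0 < c ∧ ∀ g : ℝ → ℝ, MemRestrict (T.kernel₁ j) (Ioo 0 1) g →
    ∃ g' : ℝ → ℝ, IsH1 g g' ∧
      c * ∫ x in Ioo (0 : ℝ) 1, g' x ^ 2 ≤ restrictNorm (T.kernel₁ j) (Ioo 0 1) g ^ 2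
  upper : ∀ j, ∃ c : ℝ, 0 < c ∧ ∀ g g' : ℝ → ℝ, ContinuousOn g (Ioo 0 1) → IsH1 g g' →
    MemRestrict (T.kernel₁ j) (Ioo 0 1) g ∧
      restrictNorm (T.kernel₁ j) (Ioo 0 1) g ^ 2 ≤
        c * ((∫ x in Ioo (0 : ℝ) 1, g x ^ 2) + ∫ x in Ioo (0 : ℝ) 1, g' x ^ 2)

/-- The design space `(0, 1)^d`. -/
def unitCube (d : ℕ) : Set (Fin d → ℝ) := {x | ∀ j, x j ∈ Ioo (0 : ℝ) 1}

/-- `f`, as a function on `(0, 1)^d`, belongs to the restriction of the reproducing kernel Hilbert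
space of the tensor Markov kernel. -/
def TMKernel.Mem {d : ℕ} (T : TMKernel d) (f : (Fin d → ℝ) → ℝ) : Prop :=
  MemRestrict T.kernel (unitCube d) f

/-- The norm of that restricted space. -/
def TMKernel.norm {d : ℕ} (T : TMKernel d) (f : (Fin d → ℝ) → ℝ) : ℝ :=
  restrictNorm T.kernel (unitCube d) f

/-! ### Sparse grids -/

open scoped Classical in
/-- The points `i / 2 ^ l` with `1 ≤ i ≤ 2 ^ l - 1`. -/
def dyadicGrid (l : ℕ) : Finset ℝ :=
  (Finset.Icc 1 (2 ^ l - 1)).image fun i : ℕ => (i : ℝ) / 2 ^ l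

open scoped Classical in
/-- The classical sparse grid of level `τ`: the union of the full grids of levels
`l = (l_1, …, l_d)` with all `l_j ≥ 1` and `l_1 + ⋯ + l_d ≤ τ + d - 1`. (The bound on the single
`l_j` in the index set follows from the bound on the sum.) -/
def sparseGrid (d τ : ℕ) : Finset (Fin d → ℝ) :=
  ((Fintype.piFinset fun _ : Fin d => Finset.Icc 1 (τ + d - 1)).filter
    fun l => ∑ j, l j ≤ τ + d - 1).biUnion fun l => Fintype.piFinset fun j => dyadicGrid (l j)

open scoped Classical in
/-- `S` is a truncated sparse grid of size `n`. -/
def IsTruncatedSparseGrid (d n : ℕ) (S : Finset (Fin d → ℝ)) : Prop :=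
  ∃ τ : ℕ, 1 ≤ τ ∧ (sparseGrid d τ).card ≤ n ∧ n < (sparseGrid d (τ + 1)).card ∧
    ∃ A ⊆ sparseGrid d (τ + 1) \ sparseGrid d τ,
      A.card = n - (sparseGrid d τ).card ∧ S = sparseGrid d τ ∪ A

open scoped Classical in
/-- The points `x 0, …, x (n - 1)` form a truncated sparse grid of size `n`. (They are then
pairwise distinct, since their set has `n` elements.) -/
def FormTruncatedSparseGrid {d n : ℕ} (x : Fin n → Fin d → ℝ) : Prop :=
  IsTruncatedSparseGrid d n (Finset.univ.image x)

/-- The empirical semi-norm at the design points `x 0, …, x (n - 1)`. -/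
def empiricalNorm {d n : ℕ} (x : Fin n → Fin d → ℝ) (f : (Fin d → ℝ) → ℝ) : ℝ :=
  √((1 / (n : ℝ)) * ∑ i, f (x i) ^ 2)

end SparseGrid

end

noncomputable section

namespace SparseGrid

/-! ### Bessel-type bounds and their tensor products -/

section Hilbert

variable {ι H : Type*} [Fintype ι] [NormedAddCommGroup H] [InnerProductSpace ℝ H]

/-! Write `d = D + 1` and `f x = ⟪e x, h⟫`, where `e x` is the kernel section at `x` and `h` is an
extension of `f`. Let `P_l` be piecewise constant interpolation at dyadic level `l` in one variable,
with `P_0 = 0`. The tensor power of `P_L` applied to `f` converges pointwise to `f` as `L → ∞`, so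
by Fatou it suffices to bound it uniformly in `L`.

In the last `D` variables telescope `P_L = ∑_{r<L} (P_{r+1} - P_r)`. This gives a sum over `ρ ∈ {0,
…, L-1}^D`. For each `ρ` split the first factor as `(P_L - P_m) + P_m` with `m = max(τ - |ρ|, 0)`
(`gridComb_levelVec_eq_sum`).

In the first piece every factor is a difference. In one variable `P_m - P_n` has norm `O(2^{-n})`
from the RKHS to `L²`, by the Sobolev estimate. Such bounds multiply under tensor products
(`sum_inner_sq_le_prod`), so the piece is `O(2^{-max(|ρ|, τ)} ‖h‖)`. Summing over `ρ` gives `τ^D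
2^{-τ} ‖h‖` up to constants.

The second piece vanishes unless `|ρ| < τ`. It expands into `2^D` signed products of interpolations
whose levels sum to between `τ` and `τ + D`. These only sample `f` on the sparse grid of level `τ`,
with cells of volume `O(2^{-τ})`, so each has norm `O((2^{-τ} ∑ f²)^{1/2})`. There are at most `τ^D`
such `ρ`.

Finally `n ≲ τ^D 2^τ` and `τ ≲ log n` turn these bounds into `n⁻¹ (log n)^{2D} ‖h‖` and `(log
n)^{3D/2} ‖f‖_n`; the infimum over `h` gives the restricted norm. -/

theorem dotProduct_gram_mulVec (a : ι → H) (y : ι → ℝ) :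
    y ⬝ᵥ ((Matrix.gram ℝ a).mulVec y) = ‖∑ c, y c • a c‖ ^ 2 := by
  rw [← real_inner_self_eq_norm_sq, sum_inner]
  simp only [dotProduct, Matrix.mulVec, Matrix.gram_apply, inner_sum, Finset.mul_sum,
    real_inner_smul_left, real_inner_smul_right]
  exact Finset.sum_congr rfl fun i _ => Finset.sum_congr rfl fun j _ => by ring

theorem posSemidef_smul_one_sub_gram_iff [DecidableEq ι] (a : ι → H) (M : ℝ) :
    (M • (1 : Matrix ι ι ℝ) - Matrix.gram ℝ a).PosSemidef ↔
      ∀ y : ι → ℝ, ‖∑ c, y c • a c‖ ^ 2 ≤ M * ∑ c, y c ^ 2 := by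
  have key : ∀ y : ι → ℝ, y ⬝ᵥ ((M • (1 : Matrix ι ι ℝ) - Matrix.gram ℝ a).mulVec y) =
      M * ∑ c, y c ^ 2 - ‖∑ c, y c • a c‖ ^ 2 := by
    intro y
    rw [Matrix.sub_mulVec, dotProduct_sub, dotProduct_gram_mulVec, Matrix.smul_mulVec,
      Matrix.one_mulVec, dotProduct_smul]
    simp [dotProduct, sq]
  constructor
  · intro h y
    have := h.re_dotProduct_nonneg y
    simp only [star_trivial, key, RCLike.re_to_real] at this
    linarith
  · intro h
    refine Matrix.PosSemidef.of_dotProduct_mulVec_nonneg ?_ fun y => ?_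
    · refine Matrix.IsHermitian.sub ?_ (Matrix.posSemidef_gram ℝ a).isHermitian
      ext i j
      simp [Matrix.one_apply, eq_comm]
    · rw [star_trivial, key]
      linarith [h y]

/-- The synthesis map `y ↦ ∑ y c • a c` is adjoint to the analysis map `g ↦ (⟪a c, g⟫)_c`, so both
have the same norm. Together with the converse below, this turns a Bessel bound into a matrix
inequality for the Gram matrix. -/
theorem norm_sum_smul_sq_le_of_sum_inner_sq_le (a : ι → H) {M : ℝ} (hM : 0 ≤ M)
    (h : ∀ g, ∑ c, inner ℝ (a c) g ^ 2 ≤ M * ‖g‖ ^ 2) (y : ι → ℝ) :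
    ‖∑ c, y c • a c‖ ^ 2 ≤ M * ∑ c, y c ^ 2 := by
  set g := ∑ c, y c • a c with hg
  have h1 : ‖g‖ ^ 2 = ∑ c, y c * inner ℝ (a c) g := by
    rw [← real_inner_self_eq_norm_sq]
    nth_rw 1 [hg]
    simp [sum_inner, real_inner_smul_left]
  have h2 : (‖g‖ ^ 2) ^ 2 ≤ (∑ c, y c ^ 2) * (M * ‖g‖ ^ 2) := by
    conv_lhs => rw [h1]
    exact (Finset.sum_mul_sq_le_sq_mul_sq _ _ _).trans
      (mul_le_mul_of_nonneg_left (h g) (Finset.sum_nonneg fun _ _ => sq_nonneg _))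
  rcases (sq_nonneg ‖g‖).eq_or_lt with h0 | h0
  · rw [← h0]
    exact mul_nonneg hM (Finset.sum_nonneg fun _ _ => sq_nonneg _)
  · refine le_of_mul_le_mul_right ?_ h0
    linarith

theorem sum_inner_sq_le_of_norm_sum_smul_sq_le (a : ι → H) {M : ℝ} (hM : 0 ≤ M)
    (h : ∀ y : ι → ℝ, ‖∑ c, y c • a c‖ ^ 2 ≤ M * ∑ c, y c ^ 2) (g : H) :
    ∑ c, inner ℝ (a c) g ^ 2 ≤ M * ‖g‖ ^ 2 := by
  set y : ι → ℝ := fun c => inner ℝ (a c) g with hy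
  set s := ∑ c, y c ^ 2 with hs
  have h1 : s = inner ℝ (∑ c, y c • a c) g := by
    simp [hs, sum_inner, real_inner_smul_left, hy, sq]
  have h2 : s ^ 2 ≤ M * s * ‖g‖ ^ 2 := by
    calc s ^ 2 ≤ (‖∑ c, y c • a c‖ * ‖g‖) ^ 2 := by
          rw [sq_le_sq, abs_of_nonneg (a := ‖_‖ * _) (by positivity)]
          conv_lhs => rw [h1]
          exact abs_real_inner_le_norm _ _
      _ = ‖∑ c, y c • a c‖ ^ 2 * ‖g‖ ^ 2 := by ring
      _ ≤ M * s * ‖g‖ ^ 2 := mul_le_mul_of_nonneg_right (h y) (sq_nonneg _)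
  have hs0 : 0 ≤ s := Finset.sum_nonneg fun _ _ => sq_nonneg _
  rcases hs0.eq_or_lt with h0 | h0
  · rw [← h0]
    positivity
  · refine le_of_mul_le_mul_right ?_ h0
    linarith

/-- Induction on the number of factors through `M₀M' - G₀ ⊗ T = (M₀ - G₀) ⊗ T + M₀ ⊗ (M' - T)`, in
which both summands are Kronecker products of positive semidefinite matrices. -/
theorem posSemidef_tensor {d : ℕ} {ι : Type*} [Fintype ι] [DecidableEq ι]
    (G : Fin d → Matrix ι ι ℝ) (M : Fin d → ℝ) (hM : ∀ j, 0 ≤ M j)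
    (hG : ∀ j, (G j).PosSemidef) (hGM : ∀ j, (M j • (1 : Matrix ι ι ℝ) - G j).PosSemidef) :
    (Matrix.of fun c c' : Fin d → ι => ∏ j, G j (c j) (c' j)).PosSemidef ∧
      ((∏ j, M j) • (1 : Matrix (Fin d → ι) (Fin d → ι) ℝ) -
        Matrix.of fun c c' : Fin d → ι => ∏ j, G j (c j) (c' j)).PosSemidef := by
  induction d with
  | zero =>
    have h1 : (Matrix.of fun c c' : Fin 0 → ι => ∏ j, G j (c j) (c' j)) = 1 := by
      ext c c'
      rw [Subsingleton.elim c c']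
      simp
    rw [h1]
    refine ⟨Matrix.PosSemidef.one, ?_⟩
    simpa using Matrix.PosSemidef.zero
  | succ d ih =>
    obtain ⟨ih1, ih2⟩ := ih (fun j => G j.succ) (fun j => M j.succ) (fun j => hM _)
      (fun j => hG _) fun j => hGM _
    set T : Matrix (Fin d → ι) (Fin d → ι) ℝ :=
      Matrix.of fun c c' => ∏ j, G j.succ (c j) (c' j) with hT
    set e : (Fin (d + 1) → ι) → ι × (Fin d → ι) := fun c => (c 0, Fin.tail c) with he
    have h1 : (Matrix.of fun c c' : Fin (d + 1) → ι => ∏ j, G j (c j) (c' j)) =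
        (Matrix.kroneckerMap (· * ·) (G 0) T).submatrix e e := by
      ext c c'
      simp [hT, he, Fin.prod_univ_succ, Fin.tail]
    refine ⟨h1 ▸ ((hG 0).kronecker ih1).submatrix e, ?_⟩
    have h2 : (∏ j, M j) • (1 : Matrix (Fin (d + 1) → ι) (Fin (d + 1) → ι) ℝ) -
        Matrix.of (fun c c' : Fin (d + 1) → ι => ∏ j, G j (c j) (c' j)) =
        (Matrix.kroneckerMap (· * ·) (M 0 • (1 : Matrix ι ι ℝ) - G 0) T +
          Matrix.kroneckerMap (· * ·) (M 0 • (1 : Matrix ι ι ℝ))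
            ((∏ j : Fin d, M j.succ) • (1 : Matrix (Fin d → ι) (Fin d → ι) ℝ) - T)).submatrix
              e e := by
      rw [h1]
      ext c c'
      have h3 : (c = c') ↔ (c 0 = c' 0 ∧ Fin.tail c = Fin.tail c') := by
        constructor
        · rintro rfl
          simp
        · rintro ⟨h, h'⟩
          rw [← Fin.cons_self_tail c, ← Fin.cons_self_tail c', h, h']
      by_cases hc : c 0 = c' 0 <;> by_cases hc' : Fin.tail c = Fin.tail c' <;>
        simp [he, Fin.prod_univ_succ, Matrix.one_apply, h3, hc, hc'] <;> ring
    rw [h2]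
    exact (((hGM 0).kronecker ih1).add
      (((Matrix.PosSemidef.one).smul (hM 0)).kronecker ih2)).submatrix e

/-- `H` need not be constructed as a tensor product: a Bessel bound depends only on the Gram matrix
of the vectors, and that matrix is a Kronecker product. -/
theorem sum_inner_sq_le_prod {d : ℕ} {ι : Type*} [Fintype ι] {E : Fin d → Type*}
    [∀ j, NormedAddCommGroup (E j)] [∀ j, InnerProductSpace ℝ (E j)]
    (b : ∀ j, ι → E j) (M : Fin d → ℝ) (hM : ∀ j, 0 ≤ M j)
    (hb : ∀ j g, ∑ c, inner ℝ (b j c) g ^ 2 ≤ M j * ‖g‖ ^ 2)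
    (a : (Fin d → ι) → H)
    (ha : ∀ c c', inner ℝ (a c) (a c') = ∏ j, inner ℝ (b j (c j)) (b j (c' j))) (g : H) :
    ∑ c, inner ℝ (a c) g ^ 2 ≤ (∏ j, M j) * ‖g‖ ^ 2 := by
  classical
  refine sum_inner_sq_le_of_norm_sum_smul_sq_le a (Finset.prod_nonneg fun j _ => hM j) ?_ g
  rw [← posSemidef_smul_one_sub_gram_iff]
  have h1 : Matrix.gram ℝ a =
      Matrix.of fun c c' : Fin d → ι => ∏ j, Matrix.gram ℝ (b j) (c j) (c' j) := by
    ext c c'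
    simp [Matrix.gram_apply, ha]
  rw [h1]
  exact (posSemidef_tensor _ M hM (fun j => Matrix.posSemidef_gram ℝ (b j)) fun j =>
    (posSemidef_smul_one_sub_gram_iff (b j) (M j)).2
      (norm_sum_smul_sq_le_of_sum_inner_sq_le (b j) (hM j) (hb j))).2

end Hilbert

/-! ### Increments of continuous functions with square integrable weak derivative -/

section Sobolev

/-- The derivative of the rescaled smooth step is a probability density supported in `[r, r + ε]`,
so integrating against it averages `g` there. -/
theorem abs_integral_mul_deriv_smoothTransition_sub_le {g : ℝ → ℝ}
    (hg : IntegrableOn g (Ioo 0 1)) {r ε v η : ℝ} (hε : 0 < ε) (hr : 0 < r) (hr' : r + ε < 1)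
    (h : ∀ x ∈ Icc r (r + ε), |g x - v| ≤ η) :
    IntegrableOn (fun x => g x * deriv (fun x => Real.smoothTransition ((x - r) / ε)) x)
      (Ioo 0 1) ∧
    |(∫ x in Ioo (0 : ℝ) 1, g x * deriv (fun x => Real.smoothTransition ((x - r) / ε)) x) - v|
      ≤ η := by
  set σ : ℝ → ℝ := fun x => Real.smoothTransition ((x - r) / ε) with hσ
  have hσs : ContDiff ℝ 1 σ :=
    (Real.smoothTransition.contDiff (n := 1)).comp ((contDiff_id.sub contDiff_const).div_const _)
  have hA : Continuous (deriv σ) := hσs.continuous_deriv le_rfl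
  have hmono : Monotone σ := fun x y hxy => Real.smoothTransition.monotone (by gcongr)
  have hA0 : ∀ x, 0 ≤ deriv σ x := fun x => hmono.deriv_nonneg
  have hleft : ∀ x, x < r → deriv σ x = 0 := by
    intro x hx
    have : σ =ᶠ[nhds x] fun _ => 0 := by
      filter_upwards [Iio_mem_nhds hx] with y hy
      exact Real.smoothTransition.zero_of_nonpos
        (div_nonpos_of_nonpos_of_nonneg (sub_nonpos.2 (le_of_lt hy)) hε.le)
    rw [this.deriv_eq, deriv_const]
  have hright : ∀ x, r + ε < x → deriv σ x = 0 := by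
    intro x hx
    have : σ =ᶠ[nhds x] fun _ => 1 := by
      filter_upwards [Ioi_mem_nhds hx] with y hy
      refine Real.smoothTransition.one_of_one_le ((one_le_div hε).2 ?_)
      have : r + ε < y := hy
      linarith
    rw [this.deriv_eq, deriv_const]
  have hAi : IntegrableOn (deriv σ) (Ioo 0 1) :=
    (hA.integrableOn_Icc (a := 0) (b := 1)).mono_set Ioo_subset_Icc_self
  have hA1 : ∫ x in Ioo (0 : ℝ) 1, deriv σ x = 1 := by
    rw [← integral_Ioc_eq_integral_Ioo, ← intervalIntegral.integral_of_le zero_le_one,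
      intervalIntegral.integral_deriv_eq_sub
        (fun x _ => (hσs.differentiable one_ne_zero).differentiableAt)
        (hA.intervalIntegrable _ _)]
    have h1 : σ 1 = 1 := Real.smoothTransition.one_of_one_le ((one_le_div hε).2 (by linarith))
    have h0 : σ 0 = 0 := Real.smoothTransition.zero_of_nonpos
      (div_nonpos_of_nonpos_of_nonneg (by linarith) hε.le)
    rw [h1, h0, sub_zero]
  obtain ⟨B, hB⟩ := isCompact_Icc.exists_bound_of_continuousOn (s := Icc (0 : ℝ) 1)
    hA.continuousOn
  have hgA : IntegrableOn (fun x => g x * deriv σ x) (Ioo 0 1) := by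
    refine Integrable.mul_bdd (c := B) hg hA.aestronglyMeasurable ?_
    filter_upwards [self_mem_ae_restrict measurableSet_Ioo] with x hx
    exact hB x (Ioo_subset_Icc_self hx)
  refine ⟨hgA, ?_⟩
  have h1 : (∫ x in Ioo (0 : ℝ) 1, g x * deriv σ x) - v =
      ∫ x in Ioo (0 : ℝ) 1, (g x - v) * deriv σ x := by
    simp_rw [sub_mul]
    rw [integral_sub hgA (hAi.const_mul v), integral_const_mul, hA1, mul_one]
  have h2 : η = ∫ x in Ioo (0 : ℝ) 1, η * deriv σ x := by
    rw [integral_const_mul, hA1, mul_one]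
  rw [h1, ← Real.norm_eq_abs, h2]
  refine norm_integral_le_of_norm_le (hAi.const_mul η) (Filter.Eventually.of_forall fun x => ?_)
  rw [norm_mul, Real.norm_eq_abs, Real.norm_eq_abs, abs_of_nonneg (hA0 x)]
  by_cases hx : x ∈ Icc r (r + ε)
  · exact mul_le_mul_of_nonneg_right (h x hx) (hA0 x)
  · rw [mem_Icc, not_and_or, not_le, not_le] at hx
    rcases hx with hx | hx
    · simp [hleft x hx]
    · simp [hright x hx]

theorem sq_integral_abs_le {u : ℝ → ℝ} {s t : ℝ} (hst : s < t)
    (hu : MemLp u 2 (volume.restrict (Ioc s t))) :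
    (∫ x in Ioc s t, |u x|) ^ 2 ≤ (t - s) * ∫ x in Ioc s t, u x ^ 2 := by
  set K := ∫ x in Ioc s t, |u x| with hK
  have hu1 : Integrable (fun x => |u x|) (volume.restrict (Ioc s t)) :=
    (hu.integrable one_le_two).abs
  have hu2 : Integrable (fun x => u x ^ 2) (volume.restrict (Ioc s t)) := hu.integrable_sq
  have h0 : 0 ≤ ∫ x in Ioc s t, ((t - s) * |u x| - K) ^ 2 :=
    integral_nonneg fun x => sq_nonneg _
  have h1 : ∀ x, ((t - s) * |u x| - K) ^ 2 =
      (t - s) ^ 2 * u x ^ 2 - 2 * (t - s) * K * |u x| + K ^ 2 := by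
    intro x
    rw [← sq_abs (u x)]
    ring
  simp_rw [h1] at h0
  have h2 : Integrable (fun x => (t - s) ^ 2 * u x ^ 2 - 2 * (t - s) * K * |u x|)
      (volume.restrict (Ioc s t)) := (hu2.const_mul _).sub (hu1.const_mul _)
  rw [integral_add h2 (integrable_const _), integral_sub (hu2.const_mul _) (hu1.const_mul _),
    integral_const_mul, integral_const_mul,
    ← hK] at h0
  simp only [integral_const, MeasurableSet.univ, measureReal_restrict_apply, univ_inter,
    Real.volume_real_Ioc_of_le hst.le, smul_eq_mul] at h0
  have hst' : 0 < t - s := sub_pos.2 hst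
  refine le_of_mul_le_mul_left ?_ hst'
  nlinarith

/-- Test the weak derivative against a difference of two smooth steps, one rising just after `s` and
one rising just before `t`. This approximates the indicator of `(s, t]`, and gives `|g t - g s| ≤ ∫
|g'|`; Cauchy–Schwarz finishes. -/
theorem IsH1.sq_sub_le {g g' : ℝ → ℝ} (hg : ContinuousOn g (Ioo 0 1)) (h : IsH1 g g') {s t : ℝ}
    (hs : s ∈ Ioo (0 : ℝ) 1) (ht : t ∈ Ioo (0 : ℝ) 1) (hst : s ≤ t) :
    (g t - g s) ^ 2 ≤ (t - s) * ∫ x in Ioc s t, g' x ^ 2 := by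
  rcases hst.eq_or_lt with rfl | hst
  · simp
  have hsub : Ioc s t ⊆ Ioo 0 1 := fun x hx => ⟨hs.1.trans hx.1, hx.2.trans_lt ht.2⟩
  have hmem : MemLp g' 2 (volume.restrict (Ioc s t)) :=
    h.memLp_deriv.mono_measure (Measure.restrict_mono hsub le_rfl)
  refine le_trans ?_ (sq_integral_abs_le hst hmem)
  have hgi : IntegrableOn g (Ioo 0 1) := h.memLp.integrable one_le_two
  have hgi' : IntegrableOn g' (Ioo 0 1) := h.memLp_deriv.integrable one_le_two
  rw [sq_le_sq, abs_of_nonneg (a := integral _ _) (integral_nonneg fun _ => abs_nonneg _)]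
  refine le_of_forall_pos_le_add fun η hη => ?_
  have hcs := Metric.continuousAt_iff.1 (hg.continuousAt (isOpen_Ioo.mem_nhds hs)) (η / 2)
    (half_pos hη)
  have hct := Metric.continuousAt_iff.1 (hg.continuousAt (isOpen_Ioo.mem_nhds ht)) (η / 2)
    (half_pos hη)
  obtain ⟨ε₁, hε₁, h₁⟩ := hcs
  obtain ⟨ε₂, hε₂, h₂⟩ := hct
  -- Both transition windows must stay within the continuity radii at `s` and `t`, and the rise
  -- after `s` must end before the rise before `t` begins.
  set ε := min (min (ε₁ / 2) (ε₂ / 2)) ((t - s) / 2) with hεdef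
  have hst' : 0 < t - s := sub_pos.2 hst
  have hε : 0 < ε := by positivity
  have hle1 : ε ≤ ε₁ / 2 := (min_le_left _ _).trans (min_le_left _ _)
  have hle2 : ε ≤ ε₂ / 2 := (min_le_left _ _).trans (min_le_right _ _)
  have hle3 : ε ≤ (t - s) / 2 := min_le_right _ _
  have hs0 := hs.1
  have ht1 := ht.2
  obtain ⟨i1, b1⟩ := abs_integral_mul_deriv_smoothTransition_sub_le hgi (r := s) (v := g s)
    (η := η / 2) hε hs0 (by linarith) fun x hx => (h₁ (by
      rw [Real.dist_eq, abs_of_nonneg (by linarith [hx.1])]; linarith [hx.2])).le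
  obtain ⟨i2, b2⟩ := abs_integral_mul_deriv_smoothTransition_sub_le hgi (r := t - ε) (v := g t)
    (η := η / 2) hε (by linarith) (by linarith) fun x hx => (h₂ (by
      rw [Real.dist_eq, abs_sub_comm, abs_of_nonneg (by linarith [hx.2])]; linarith [hx.1])).le
  set σ : ℝ → ℝ := fun x => Real.smoothTransition ((x - s) / ε) with hσ
  set τ : ℝ → ℝ := fun x => Real.smoothTransition ((x - (t - ε)) / ε) with hτ
  have hσs : ContDiff ℝ (⊤ : ℕ∞) σ :=
    Real.smoothTransition.contDiff.comp ((contDiff_id.sub contDiff_const).div_const _)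
  have hτs : ContDiff ℝ (⊤ : ℕ∞) τ :=
    Real.smoothTransition.contDiff.comp ((contDiff_id.sub contDiff_const).div_const _)
  have hzero : ∀ x, x ∉ Ioc s t → σ x - τ x = 0 := by
    intro x hx
    rw [mem_Ioc, not_and_or, not_lt, not_le] at hx
    rcases hx with hx | hx
    · simp only [hσ, hτ]
      rw [Real.smoothTransition.zero_of_nonpos
        (div_nonpos_of_nonpos_of_nonneg (by linarith) hε.le),
        Real.smoothTransition.zero_of_nonpos
        (div_nonpos_of_nonpos_of_nonneg (by linarith) hε.le), sub_zero]
    · simp only [hσ, hτ]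
      rw [Real.smoothTransition.one_of_one_le ((one_le_div hε).2 (by linarith)),
        Real.smoothTransition.one_of_one_le ((one_le_div hε).2 (by linarith)), sub_self]
  have htsub : tsupport (fun x => σ x - τ x) ⊆ Icc s t := by
    refine closure_minimal (fun x hx => ?_) isClosed_Icc
    by_contra hx'
    exact hx (hzero x fun hx'' => hx' (Ioc_subset_Icc_self hx''))
  have hweak := h.weakDeriv (fun x => σ x - τ x) (hσs.sub hτs)
    (HasCompactSupport.of_support_subset_isCompact isCompact_Icc
      ((subset_tsupport _).trans htsub))
    (htsub.trans fun x hx => ⟨hs.1.trans_le hx.1, hx.2.trans_lt ht.2⟩)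
  have hderiv : ∀ x, deriv (fun x => σ x - τ x) x = deriv σ x - deriv τ x := fun x =>
    deriv_fun_sub (hσs.differentiable (by simp)).differentiableAt
      (hτs.differentiable (by simp)).differentiableAt
  simp_rw [hderiv, mul_sub] at hweak
  rw [integral_sub i1 i2] at hweak
  have hbound : |∫ x in Ioo (0 : ℝ) 1, g' x * σ x - g' x * τ x| ≤ ∫ x in Ioc s t, |g' x| := by
    have h3 : ∫ x in Ioc s t, |g' x| =
        ∫ x in Ioo (0 : ℝ) 1, (Ioc s t).indicator (fun x => |g' x|) x := by
      rw [setIntegral_indicator measurableSet_Ioc, inter_eq_right.2 hsub]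
    rw [h3, ← Real.norm_eq_abs]
    refine norm_integral_le_of_norm_le ((hgi'.abs).indicator measurableSet_Ioc)
      (Filter.Eventually.of_forall fun x => ?_)
    rw [← mul_sub]
    by_cases hx : x ∈ Ioc s t
    · rw [indicator_of_mem hx, norm_mul, Real.norm_eq_abs, Real.norm_eq_abs]
      refine mul_le_of_le_one_right (abs_nonneg _) (abs_le.2 ⟨?_, ?_⟩)
      · have : τ x ≤ σ x := Real.smoothTransition.monotone (by gcongr; linarith)
        linarith
      · have h4 := Real.smoothTransition.le_one ((x - s) / ε)
        have h5 := Real.smoothTransition.nonneg ((x - (t - ε)) / ε)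
        simp only [hσ, hτ]
        linarith
    · rw [indicator_of_notMem hx, hzero x hx]
      simp
  rw [abs_le] at b1 b2 hbound ⊢
  constructor <;> linarith [b1.1, b1.2, b2.1, b2.2, hbound.1, hbound.2]

end Sobolev

/-! ### Dyadic rounding and the one-dimensional interpolation error -/

section Rounding

/-- The largest point `i / 2 ^ l ≤ x` of the dyadic grid of level `l`, or the first point of that
grid if there is none. -/
def roundDyadic (l : ℕ) (x : ℝ) : ℝ := ((max ⌊2 ^ l * x⌋₊ 1 : ℕ) : ℝ) / 2 ^ l

/-- Piecewise constant interpolation of `g` on the dyadic grid of level `l`. -/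
def levelEval (l : ℕ) (g : ℝ → ℝ) (x : ℝ) : ℝ := if l = 0 then 0 else g (roundDyadic l x)

theorem floor_two_pow_mul {m L : ℕ} (hm : m ≤ L) (x : ℝ) :
    ⌊2 ^ m * x⌋₊ = ⌊2 ^ L * x⌋₊ / 2 ^ (L - m) := by
  rw [← Nat.floor_div_natCast]
  congr 1
  rw [← Nat.sub_add_cancel hm, pow_add, Nat.add_sub_cancel]
  push_cast
  field_simp

theorem floor_two_pow_mul_div {m L : ℕ} (hm : m ≤ L) (c : ℕ) :
    ⌊(2 : ℝ) ^ m * ((c : ℝ) / 2 ^ L)⌋₊ = c / 2 ^ (L - m) := by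
  rw [floor_two_pow_mul hm, mul_div_cancel₀ _ (by positivity), Nat.floor_natCast]

theorem roundDyadic_floor {m L : ℕ} (hm : m ≤ L) (x : ℝ) :
    roundDyadic m ((⌊2 ^ L * x⌋₊ : ℝ) / 2 ^ L) = roundDyadic m x := by
  rw [roundDyadic, roundDyadic, floor_two_pow_mul_div hm, floor_two_pow_mul hm]

theorem exists_roundDyadic_eq {m : ℕ} (hm : m ≠ 0) {x : ℝ} (hx : x < 1) :
    ∃ i : ℕ, 1 ≤ i ∧ i ≤ 2 ^ m - 1 ∧ roundDyadic m x = i / 2 ^ m := by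
  refine ⟨max ⌊2 ^ m * x⌋₊ 1, le_max_right _ _, ?_, rfl⟩
  have h1 : ⌊2 ^ m * x⌋₊ < 2 ^ m := by
    rw [Nat.floor_lt' (by positivity)]
    push_cast
    exact mul_lt_of_lt_one_right (by positivity) hx
  have h2 : 2 ^ 1 ≤ 2 ^ m := Nat.pow_le_pow_right two_pos (Nat.one_le_iff_ne_zero.2 hm)
  omega

theorem roundDyadic_mem_dyadicGrid {m : ℕ} (hm : m ≠ 0) {x : ℝ} (hx : x < 1) :
    roundDyadic m x ∈ dyadicGrid m := by
  obtain ⟨i, h1, h2, h3⟩ := exists_roundDyadic_eq hm hx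
  rw [dyadicGrid, Finset.mem_image]
  exact ⟨i, Finset.mem_Icc.2 ⟨h1, h2⟩, h3.symm⟩

theorem dyadicGrid_subset (m : ℕ) : ↑(dyadicGrid m) ⊆ Ioo (0 : ℝ) 1 := by
  intro y hy
  rw [Finset.mem_coe, dyadicGrid, Finset.mem_image] at hy
  obtain ⟨i, hi, rfl⟩ := hy
  rw [Finset.mem_Icc] at hi
  have h1 : (1 : ℝ) ≤ i := by exact_mod_cast hi.1
  have h2 : (i : ℝ) < 2 ^ m := by
    have h3 : i < 2 ^ m := by have := Nat.one_le_two_pow (n := m); omega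
    exact_mod_cast h3
  exact ⟨by positivity, (div_lt_one (by positivity)).2 h2⟩

theorem abs_sub_roundDyadic_le (l : ℕ) {x : ℝ} (hx : 0 ≤ x) :
    |x - roundDyadic l x| ≤ 1 / 2 ^ l := by
  have h2 : (0 : ℝ) < 2 ^ l := by positivity
  have h3 : x - roundDyadic l x = (2 ^ l * x - ((max ⌊2 ^ l * x⌋₊ 1 : ℕ) : ℝ)) / 2 ^ l := by
    rw [roundDyadic]
    field_simp
  rw [h3, abs_div, abs_of_pos h2]
  gcongr
  have h4 := Nat.floor_le (mul_nonneg h2.le hx)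
  have h5 := Nat.lt_floor_add_one (2 ^ l * x)
  have h6 : 0 ≤ 2 ^ l * x := mul_nonneg h2.le hx
  push_cast
  rcases max_cases (⌊2 ^ l * x⌋₊ : ℝ) 1 with ⟨h, h'⟩ | ⟨h, h'⟩ <;> rw [h, abs_le] <;>
    constructor <;> linarith

/-- Dyadic cells are nested, so rounding at a finer level stays in the level-`n` cell. The cell is
closed on the right because moving `0` to the first grid point can reach the right endpoint. -/
theorem roundDyadic_div_mem {n m L : ℕ} (hnm : n ≤ m) (hm : m ≤ L) (c : ℕ) :
    roundDyadic m ((c : ℝ) / 2 ^ L) ∈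
      Icc (((c / 2 ^ (L - n) : ℕ) : ℝ) / 2 ^ n) ((((c / 2 ^ (L - n) : ℕ) : ℝ) + 1) / 2 ^ n) := by
  rw [roundDyadic, floor_two_pow_mul_div hm]
  set k := c / 2 ^ (L - m) with hk
  have he : c / 2 ^ (L - n) = k / 2 ^ (m - n) := by
    rw [hk, Nat.div_div_eq_div_mul, ← pow_add]
    congr 2
    omega
  rw [he]
  set e := k / 2 ^ (m - n) with he
  have hpos : 0 < 2 ^ (m - n) := by positivity
  have h1 : e * 2 ^ (m - n) ≤ max k 1 := (Nat.div_mul_le_self _ _).trans (le_max_left _ _)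
  have h2 : max k 1 ≤ (e + 1) * 2 ^ (m - n) := by
    have h3 : k < (e + 1) * 2 ^ (m - n) := by
      rw [mul_comm, he]
      exact Nat.lt_mul_div_succ k hpos
    exact max_le h3.le (Nat.mul_pos (Nat.succ_pos _) hpos)
  have hpow : (2 : ℝ) ^ m = 2 ^ n * 2 ^ (m - n) := by
    rw [← pow_add, Nat.add_sub_cancel' hnm]
  have h1' : (e : ℝ) * 2 ^ (m - n) ≤ (max k 1 : ℕ) := by exact_mod_cast h1
  have h2' : ((max k 1 : ℕ) : ℝ) ≤ ((e : ℝ) + 1) * 2 ^ (m - n) := by exact_mod_cast h2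
  constructor
  · rw [div_le_div_iff₀ (by positivity) (by positivity), hpow]
    calc (e : ℝ) * (2 ^ n * 2 ^ (m - n)) = e * 2 ^ (m - n) * 2 ^ n := by ring
      _ ≤ _ := by gcongr
  · rw [div_le_div_iff₀ (by positivity) (by positivity), hpow]
    calc ((max k 1 : ℕ) : ℝ) * 2 ^ n ≤ ((e : ℝ) + 1) * 2 ^ (m - n) * 2 ^ n := by gcongr
      _ = _ := by ring

theorem sum_range_mul_div (ψ : ℕ → ℝ) (a : ℕ) {b : ℕ} (hb : 0 < b) :
    ∑ c ∈ Finset.range (a * b), ψ (c / b) = b * ∑ e ∈ Finset.range a, ψ e := by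
  induction a with
  | zero => simp
  | succ a ih =>
    rw [add_mul, one_mul, Finset.sum_range_add, ih, Finset.sum_range_succ, mul_add]
    congr 1
    rw [Finset.sum_congr rfl (g := fun _ => ψ a), Finset.sum_const, Finset.card_range,
      nsmul_eq_mul]
    intro i hi
    rw [mul_comm, Nat.mul_add_div hb, Nat.div_eq_of_lt (Finset.mem_range.1 hi), add_zero]

/-- Both rounded points lie in one level-`n` cell of width `2^{-n}`, so the squared error is at most
`2^{-n}` times the energy of `g'` on that cell. Each cell contains `2^{L-n}` of the sample points,
which supplies the second factor `2^{-n}` after normalisation by `2^L`. -/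
theorem IsH1.sum_levelEval_sub_sq_le {g g' : ℝ → ℝ} (hg : ContinuousOn g (Ioo 0 1))
    (h : IsH1 g g') {B : ℝ} (hB : ∀ x ∈ Ioo (0 : ℝ) 1, |g x| ≤ B)
    (hB' : ∫ x in Ioo (0 : ℝ) 1, g' x ^ 2 ≤ B ^ 2) {n m L : ℕ} (hnm : n ≤ m) (hm : m ≤ L) :
    ∑ c ∈ Finset.range (2 ^ L), (levelEval m g ((c : ℝ) / 2 ^ L) -
      levelEval n g ((c : ℝ) / 2 ^ L)) ^ 2 ≤ 2 ^ L * ((1 / 2 ^ n) ^ 2 * B ^ 2) := by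
  have hx1 : ∀ c ∈ Finset.range (2 ^ L), (c : ℝ) / 2 ^ L < 1 := by
    intro c hc
    rw [div_lt_one (by positivity)]
    exact_mod_cast Finset.mem_range.1 hc
  have hmem : ∀ k, k ≠ 0 → ∀ c ∈ Finset.range (2 ^ L),
      roundDyadic k ((c : ℝ) / 2 ^ L) ∈ Ioo (0 : ℝ) 1 := fun k hk c hc =>
    dyadicGrid_subset k (roundDyadic_mem_dyadicGrid hk (hx1 c hc))
  -- For `n = 0` the coarse interpolant is zero, not a sample of `g`, so the sup bound on `g`
  -- replaces the increment estimate.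
  rcases Nat.eq_zero_or_pos n with rfl | hn
  · have h1 : ∀ c ∈ Finset.range (2 ^ L), (levelEval m g ((c : ℝ) / 2 ^ L) -
        levelEval 0 g ((c : ℝ) / 2 ^ L)) ^ 2 ≤ B ^ 2 := by
      intro c hc
      have hB0 : 0 ≤ B := (abs_nonneg _).trans (hB (1 / 2) (by norm_num))
      rw [levelEval, levelEval, if_pos rfl, sub_zero, sq_le_sq, abs_of_nonneg hB0]
      split_ifs with h0
      · simpa using hB0
      · exact hB _ (hmem m h0 c hc)
    refine (Finset.sum_le_sum h1).trans ?_
    simp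
  · set w : ℝ := 1 / 2 ^ n with hw
    have hw0 : 0 < w := by positivity
    have hii : IntervalIntegrable (fun x => g' x ^ 2) volume 0 1 := by
      rw [intervalIntegrable_iff_integrableOn_Ioo_of_le zero_le_one]
      exact h.memLp_deriv.integrable_sq
    set ψ : ℕ → ℝ := fun e => ∫ x in ((e : ℝ) / 2 ^ n)..((e + 1 : ℕ) : ℝ) / 2 ^ n, g' x ^ 2 with hψ
    have hsubI : ∀ e : ℕ, e < 2 ^ n →
        Icc ((e : ℝ) / 2 ^ n) (((e + 1 : ℕ) : ℝ) / 2 ^ n) ⊆ Icc 0 1 := by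
      intro e he
      refine Icc_subset_Icc (by positivity) ((div_le_one (by positivity)).2 ?_)
      exact_mod_cast he
    have hii' : ∀ a b, a ∈ Icc (0 : ℝ) 1 → b ∈ Icc (0 : ℝ) 1 →
        IntervalIntegrable (fun x => g' x ^ 2) volume a b := by
      intro a b ha hb
      refine hii.mono_set ?_
      rw [uIcc_of_le zero_le_one]
      exact uIcc_subset_Icc ha hb
    have hpt : ∀ c ∈ Finset.range (2 ^ L), (levelEval m g ((c : ℝ) / 2 ^ L) -
        levelEval n g ((c : ℝ) / 2 ^ L)) ^ 2 ≤ w * ψ (c / 2 ^ (L - n)) := by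
      intro c hc
      set e := c / 2 ^ (L - n) with he
      have hen : e < 2 ^ n := by
        rw [he, Nat.div_lt_iff_lt_mul (by positivity), ← pow_add,
          Nat.add_sub_cancel' (hnm.trans hm)]
        exact Finset.mem_range.1 hc
      have hy := roundDyadic_div_mem hnm hm c
      have hz := roundDyadic_div_mem le_rfl (hnm.trans hm) c
      have hy' := hmem m (by omega) c hc
      have hz' := hmem n (by omega) c hc
      rw [levelEval, levelEval, if_neg (by omega), if_neg (by omega)]
      rw [← he] at hy hz
      set y := roundDyadic m ((c : ℝ) / 2 ^ L)
      set z := roundDyadic n ((c : ℝ) / 2 ^ L)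
      have hle : (e : ℝ) / 2 ^ n ≤ ((e + 1 : ℕ) : ℝ) / 2 ^ n := by gcongr; simp
      have hwid : ((e : ℝ) + 1) / 2 ^ n - (e : ℝ) / 2 ^ n = w := by rw [hw]; ring
      have key : ∀ s t, s ∈ Icc ((e : ℝ) / 2 ^ n) (((e : ℝ) + 1) / 2 ^ n) →
          t ∈ Icc ((e : ℝ) / 2 ^ n) (((e : ℝ) + 1) / 2 ^ n) → s ∈ Ioo (0 : ℝ) 1 →
          t ∈ Ioo (0 : ℝ) 1 → s ≤ t → (g t - g s) ^ 2 ≤ w * ψ e := by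
        intro s t hs ht hs' ht' hst
        refine (h.sq_sub_le hg hs' ht' hst).trans ?_
        refine mul_le_mul ?_ ?_ (integral_nonneg fun x => sq_nonneg _) hw0.le
        · linarith [hs.1, ht.2]
        · rw [← intervalIntegral.integral_of_le hst]
          refine intervalIntegral.integral_mono_interval hs.1 hst (by exact_mod_cast ht.2)
            (Filter.Eventually.of_forall fun x => sq_nonneg _)
            (hii' _ _ (hsubI e hen (left_mem_Icc.2 hle)) (hsubI e hen (right_mem_Icc.2 hle)))
      rcases le_total z y with hzy | hzy
      · exact key z y hz hy hz' hy' hzy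
      · rw [sub_sq_comm]
        exact key y z hy hz hy' hz' hzy
    refine (Finset.sum_le_sum hpt).trans ?_
    have hsum : ∑ c ∈ Finset.range (2 ^ L), ψ (c / 2 ^ (L - n)) =
        2 ^ (L - n) * ∑ e ∈ Finset.range (2 ^ n), ψ e := by
      have := sum_range_mul_div ψ (2 ^ n) (b := 2 ^ (L - n)) (by positivity)
      rw [← pow_add, Nat.add_sub_cancel' (hnm.trans hm)] at this
      rw [this]
      push_cast
      rfl
    have htel : ∑ e ∈ Finset.range (2 ^ n), ψ e ≤ B ^ 2 := by
      have := intervalIntegral.sum_integral_adjacent_intervals (f := fun x => g' x ^ 2)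
        (μ := volume) (a := fun e : ℕ => (e : ℝ) / 2 ^ n) (n := 2 ^ n) fun k hk => by
          have hle : (k : ℝ) / 2 ^ n ≤ ((k + 1 : ℕ) : ℝ) / 2 ^ n := by gcongr; simp
          exact hii' _ _ (hsubI k hk (left_mem_Icc.2 hle)) (hsubI k hk (right_mem_Icc.2 hle))
      rw [hψ, this]
      push_cast
      rw [zero_div, div_self (by positivity), intervalIntegral.integral_of_le zero_le_one,
        integral_Ioc_eq_integral_Ioo]
      exact hB'
    rw [← Finset.mul_sum, hsum]
    have hpow : (2 : ℝ) ^ L * w = 2 ^ (L - n) := by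
      rw [hw, mul_one_div, pow_sub₀ _ two_ne_zero (hnm.trans hm), div_eq_mul_inv]
    calc w * (2 ^ (L - n) * ∑ e ∈ Finset.range (2 ^ n), ψ e) ≤ w * (2 ^ (L - n) * B ^ 2) := by
          gcongr
      _ = 2 ^ L * (w ^ 2 * B ^ 2) := by rw [← hpow]; ring

end Rounding

/-! ### Kernel sections and restricted norms -/

section Sections

variable {E : Type*} {I : Set E} (K : Matrix I I (ℝ →L[ℝ] ℝ)) [Fact K.PosSemidef]

open scoped Classical in
/-- The kernel function `k(·, x)`, as an element of the reproducing kernel Hilbert space;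
zero if `x` lies outside the domain. -/
def kernelSection (x : E) : RKHS.OfKernel K :=
  if hx : x ∈ I then RKHS.kerFun (RKHS.OfKernel K) ⟨x, hx⟩ 1 else 0

theorem inner_kernelSection {x : E} (hx : x ∈ I) (h : RKHS.OfKernel K) :
    inner ℝ (kernelSection K x) h = h ⟨x, hx⟩ := by
  rw [kernelSection, dif_pos hx, RKHS.kerFun_inner]
  simp

theorem kernelSection_of_notMem {x : E} (hx : x ∉ I) : kernelSection K x = 0 := by
  rw [kernelSection, dif_neg hx]

theorem inner_kernelSection_kernelSection {x y : E} (hx : x ∈ I) (hy : y ∈ I) :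
    inner ℝ (kernelSection K x) (kernelSection K y) = K ⟨x, hx⟩ ⟨y, hy⟩ 1 := by
  rw [inner_kernelSection K hx, kernelSection, dif_pos hy, RKHS.kerFun_apply,
    RKHS.OfKernel.kernel_ofKernel]

/-- Expand `‖e x - e y‖² = k x x - 2 k x y + k y y`. -/
theorem continuousOn_kernelSection [TopologicalSpace E] {k : E → E → ℝ} {S : Set E} (hS : S ⊆ I)
    (hKk : ∀ x y : I, K x y 1 = k x y)
    (hk : ContinuousOn (fun z : E × E => k z.1 z.2) (S ×ˢ S)) :
    ContinuousOn (kernelSection K) S := by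
  intro y hy
  rw [ContinuousWithinAt, tendsto_iff_norm_sub_tendsto_zero]
  have h1 : Filter.Tendsto (fun x => k x x - 2 * k x y + k y y) (nhdsWithin y S)
      (nhds (k y y - 2 * k y y + k y y)) := by
    refine Filter.Tendsto.add (Filter.Tendsto.sub ?_ (Filter.Tendsto.const_mul _ ?_))
      tendsto_const_nhds
    · exact (hk.comp (continuousOn_id.prodMk continuousOn_id) fun x hx => ⟨hx, hx⟩) y hy
    · exact (hk.comp (continuousOn_id.prodMk continuousOn_const) fun x hx => ⟨hx, hy⟩) y hy
  have h2 := h1.sqrt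
  rw [show k y y - 2 * k y y + k y y = 0 by ring, Real.sqrt_zero] at h2
  refine h2.congr' ?_
  filter_upwards [self_mem_nhdsWithin] with x hx
  rw [← Real.sqrt_sq (norm_nonneg _), norm_sub_sq_real, ← real_inner_self_eq_norm_sq,
    ← real_inner_self_eq_norm_sq, inner_kernelSection_kernelSection K (hS hx) (hS hx),
    inner_kernelSection_kernelSection K (hS hx) (hS hy),
    inner_kernelSection_kernelSection K (hS hy) (hS hy), hKk, hKk, hKk]

theorem restrictNorm_le {X₀ : Set E} {g : E → ℝ} {h : RKHS.OfKernel K}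
    (hh : h ∈ extensions K X₀ g) : restrictNorm K X₀ g ≤ ‖h‖ :=
  csInf_le ⟨0, by rintro _ ⟨h, -, rfl⟩; exact norm_nonneg _⟩ ⟨h, hh, rfl⟩

theorem restrictNorm_nonneg (X₀ : Set E) (g : E → ℝ) : 0 ≤ restrictNorm K X₀ g :=
  Real.sInf_nonneg (by rintro _ ⟨h, -, rfl⟩; exact norm_nonneg _)

theorem inner_kernelSection_mem_extensions {X₀ : Set E} (h : RKHS.OfKernel K) :
    h ∈ extensions K X₀ fun x => inner ℝ (kernelSection K x) h :=
  fun x _ => (inner_kernelSection K x.2 h).symm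

end Sections

/-! ### Tensor structure and one-dimensional bounds for the kernel -/

namespace TMKernel

variable {d : ℕ} (T : TMKernel d)

theorem kernel₁_apply_one (j : Fin d) (x y : T.side j) : T.kernel₁ j x y 1 = T.factor j x y := by
  simp [kernel₁, scalarKernel]

theorem kernel_apply_one (x y : T.box) :
    T.kernel x y 1 = ∏ j, T.factor j (x.1 j) (y.1 j) := by
  simp [kernel, scalarKernel]

/-- Since sections vanish off their domain, the factorisation needs no membership assumption. -/
theorem inner_kernelSection_eq_prod (x y : Fin d → ℝ) :
    inner ℝ (kernelSection T.kernel x) (kernelSection T.kernel y) =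
      ∏ j, inner ℝ (kernelSection (T.kernel₁ j) (x j)) (kernelSection (T.kernel₁ j) (y j)) := by
  by_cases hx : x ∈ T.box
  · by_cases hy : y ∈ T.box
    · rw [inner_kernelSection_kernelSection _ hx hy, kernel_apply_one]
      refine Finset.prod_congr rfl fun j _ => ?_
      rw [inner_kernelSection_kernelSection _ (hx j) (hy j), kernel₁_apply_one]
    · rw [kernelSection_of_notMem _ hy, inner_zero_right]
      simp only [box, mem_ofPred_eq, not_forall] at hy
      obtain ⟨j, hj⟩ := hy
      rw [Finset.prod_eq_zero (Finset.mem_univ j)]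
      rw [kernelSection_of_notMem _ hj, inner_zero_right]
  · rw [kernelSection_of_notMem _ hx, inner_zero_left]
    simp only [box, mem_ofPred_eq, not_forall] at hx
    obtain ⟨j, hj⟩ := hx
    rw [Finset.prod_eq_zero (Finset.mem_univ j)]
    rw [kernelSection_of_notMem _ hj, inner_zero_left]

variable {T}

theorem Regular.Ioo_subset_side (hT : T.Regular) (j : Fin d) : Ioo (0 : ℝ) 1 ⊆ T.side j := by
  intro x hx
  refine ⟨(hT.a_le j).trans_lt ?_, lt_of_lt_of_le ?_ (hT.le_b j)⟩
  · exact_mod_cast hx.1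
  · exact_mod_cast hx.2

theorem Regular.unitCube_subset_box (hT : T.Regular) : unitCube d ⊆ T.box :=
  fun _ hx j => hT.Ioo_subset_side j (hx j)

theorem Regular.continuousOn_factor (hT : T.Regular) (j : Fin d) :
    ContinuousOn (fun z : ℝ × ℝ => T.factor j z.1 z.2) (T.side j ×ˢ T.side j) := by
  refine ContinuousOn.mul
    ((hT.continuous_p j).comp (continuous_fst.min continuous_snd).continuousOn ?_)
    ((hT.continuous_q j).comp (continuous_fst.max continuous_snd).continuousOn ?_)
  · rintro ⟨x, y⟩ ⟨hx, hy⟩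
    rcases min_choice x y with h | h <;> simp only [h] <;> assumption
  · rintro ⟨x, y⟩ ⟨hx, hy⟩
    rcases max_choice x y with h | h <;> simp only [h] <;> assumption

theorem Regular.continuousOn_kernelSection₁ (hT : T.Regular) (j : Fin d) :
    ContinuousOn (kernelSection (T.kernel₁ j)) (Ioo 0 1) :=
  (continuousOn_kernelSection _ Subset.rfl (T.kernel₁_apply_one j)
    (hT.continuousOn_factor j)).mono (hT.Ioo_subset_side j)

theorem Regular.continuousOn_kernelSection (hT : T.Regular) :
    ContinuousOn (kernelSection T.kernel) (unitCube d) := by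
  refine (SparseGrid.continuousOn_kernelSection (k := fun x y => ∏ j, T.factor j (x j) (y j)) _
    Subset.rfl T.kernel_apply_one ?_).mono hT.unitCube_subset_box
  refine continuousOn_finsetProd _ fun j _ => ?_
  exact (hT.continuousOn_factor j).comp (f := fun z : (Fin d → ℝ) × (Fin d → ℝ) => (z.1 j, z.2 j))
    (by fun_prop) fun z hz => ⟨hz.1 j, hz.2 j⟩

theorem Regular.exists_sum_levelEval_sub_sq_le (hT : T.Regular) (j : Fin d) :
    ∃ B : ℝ, 0 ≤ B ∧ ∀ (h : RKHS.OfKernel (T.kernel₁ j)) (n m L : ℕ), n ≤ m → m ≤ L →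
      ∑ c ∈ Finset.range (2 ^ L),
        (levelEval m (fun x => inner ℝ (kernelSection (T.kernel₁ j) x) h) ((c : ℝ) / 2 ^ L) -
          levelEval n (fun x => inner ℝ (kernelSection (T.kernel₁ j) x) h) ((c : ℝ) / 2 ^ L)) ^ 2
        ≤ 2 ^ L * (((1 / 2 ^ n) * B) ^ 2 * ‖h‖ ^ 2) := by
  obtain ⟨c, hc, hlow⟩ := hT.lower j
  set e := kernelSection (T.kernel₁ j) with he
  have hsq : 0 ≤ √(1 / c) := Real.sqrt_nonneg _
  -- The first term bounds the value at the midpoint, the second bounds both the oscillation and the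
  -- `L²` norm of the derivative.
  refine ⟨‖e (1 / 2)‖ + √(1 / c), by positivity, fun h n m L hnm hm => ?_⟩
  set g : ℝ → ℝ := fun x => inner ℝ (e x) h with hg
  have hmem : h ∈ extensions (T.kernel₁ j) (Ioo 0 1) g := inner_kernelSection_mem_extensions _ h
  obtain ⟨g', hg', hle⟩ := hlow g ⟨h, hmem⟩
  have hcont : ContinuousOn g (Ioo 0 1) :=
    (hT.continuousOn_kernelSection₁ j).inner continuousOn_const
  have hD : ∫ x in Ioo (0 : ℝ) 1, g' x ^ 2 ≤ (√(1 / c) * ‖h‖) ^ 2 := by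
    have h1 : restrictNorm (T.kernel₁ j) (Ioo 0 1) g ^ 2 ≤ ‖h‖ ^ 2 := by
      have := restrictNorm_nonneg (T.kernel₁ j) (Ioo 0 1) g
      have := restrictNorm_le _ hmem
      gcongr
    rw [mul_pow, Real.sq_sqrt (by positivity), one_div, ← div_eq_inv_mul, le_div_iff₀ hc, mul_comm]
    exact hle.trans h1
  have hincr : ∀ s t, s ∈ Ioo (0 : ℝ) 1 → t ∈ Ioo (0 : ℝ) 1 → s ≤ t →
      |g t - g s| ≤ √(1 / c) * ‖h‖ := by
    intro s t hs ht hst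
    refine abs_le_of_sq_le_sq ?_ (by positivity)
    refine le_trans ((hg'.sq_sub_le hcont hs ht hst).trans ?_) hD
    have hsub : Ioc s t ⊆ Ioo 0 1 := fun x hx => ⟨hs.1.trans hx.1, hx.2.trans_lt ht.2⟩
    refine (mul_le_of_le_one_left (integral_nonneg fun _ => sq_nonneg _)
      (by linarith [hs.1, ht.2])).trans ?_
    exact setIntegral_mono_set hg'.memLp_deriv.integrable_sq
      (Filter.Eventually.of_forall fun _ => sq_nonneg _) hsub.eventuallyLE
  have hhalf : (1 / 2 : ℝ) ∈ Ioo (0 : ℝ) 1 := by norm_num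
  have hB : ∀ x ∈ Ioo (0 : ℝ) 1, |g x| ≤ (‖e (1 / 2)‖ + √(1 / c)) * ‖h‖ := by
    intro x hx
    have h1 : |g (1 / 2)| ≤ ‖e (1 / 2)‖ * ‖h‖ := abs_real_inner_le_norm _ _
    have h2 : |g x - g (1 / 2)| ≤ √(1 / c) * ‖h‖ := by
      rcases le_total x (1 / 2) with h | h
      · rw [abs_sub_comm]
        exact hincr _ _ hx hhalf h
      · exact hincr _ _ hhalf hx h
    have h3 : |g x| ≤ |g x - g (1 / 2)| + |g (1 / 2)| := by
      simpa using abs_add_le (g x - g (1 / 2)) (g (1 / 2))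
    linarith
  refine (hg'.sum_levelEval_sub_sq_le hcont hB (hD.trans ?_) hnm hm).trans (le_of_eq (by ring))
  gcongr
  exact le_add_of_nonneg_left (norm_nonneg _)

end TMKernel

/-! ### `L²` norms of functions with finitely many values -/

section LTwo

variable {X Y : Type*} [MeasurableSpace X] [MeasurableSpace Y] [MeasurableSingletonClass Y]
  {μ : Measure X} {P : X → Y} {F : Finset Y} {A : Set X} {v : ℝ≥0∞}

theorem setLIntegral_comp_le_mul_sum (hP : Measurable P) (hF : ∀ᵐ x ∂μ.restrict A, P x ∈ F)
    (hv : ∀ y ∈ F, μ.restrict A (P ⁻¹' {y}) ≤ v) (G : Y → ℝ≥0∞) :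
    ∫⁻ x in A, G (P x) ∂μ ≤ v * ∑ y ∈ F, G y := by
  have hm : ∀ y, MeasurableSet (P ⁻¹' {y}) := fun y => hP (measurableSet_singleton y)
  calc ∫⁻ x in A, G (P x) ∂μ
      ≤ ∫⁻ x in A, ∑ y ∈ F, G y * (P ⁻¹' {y}).indicator 1 x ∂μ := by
        refine lintegral_mono_ae ?_
        filter_upwards [hF] with x hx
        refine le_trans (le_of_eq ?_) (Finset.single_le_sum (fun _ _ => zero_le) hx)
        simp
    _ = ∑ y ∈ F, G y * μ.restrict A (P ⁻¹' {y}) := by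
        rw [lintegral_finsetSum _ fun y _ => (measurable_one.indicator (hm y)).const_mul _]
        refine Finset.sum_congr rfl fun y _ => ?_
        rw [lintegral_const_mul _ (measurable_one.indicator (hm y)), lintegral_indicator_one (hm y)]
    _ ≤ v * ∑ y ∈ F, G y := by
        rw [Finset.mul_sum]
        refine Finset.sum_le_sum fun y hy => ?_
        rw [mul_comm]
        gcongr
        exact hv y hy

theorem eLpNorm_two_comp_le (hP : Measurable P) (hF : ∀ᵐ x ∂μ.restrict A, P x ∈ F) {v : ℝ}
    (hv0 : 0 ≤ v) (hv : ∀ y ∈ F, μ.restrict A (P ⁻¹' {y}) ≤ ENNReal.ofReal v) (G : Y → ℝ) {c : ℝ}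
    (hc : 0 ≤ c) (h : v * ∑ y ∈ F, G y ^ 2 ≤ c ^ 2) :
    eLpNorm (fun x => G (P x)) 2 (μ.restrict A) ≤ ENNReal.ofReal c := by
  rw [eLpNorm_eq_lintegral_rpow_enorm_toReal two_ne_zero ENNReal.ofNat_ne_top]
  have h1 := setLIntegral_comp_le_mul_sum hP hF hv fun y => ‖G y‖ₑ ^ (2 : ℝ)
  have h2 : ENNReal.ofReal v * ∑ y ∈ F, ‖G y‖ₑ ^ (2 : ℝ) ≤ ENNReal.ofReal c ^ (2 : ℝ) := by
    have h3 : ∀ y, ‖G y‖ₑ ^ (2 : ℝ) = ENNReal.ofReal (G y ^ 2) := by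
      intro y
      rw [← ofReal_norm, ENNReal.ofReal_rpow_of_nonneg (norm_nonneg _) two_pos.le]
      norm_num
    simp_rw [h3]
    rw [← ENNReal.ofReal_sum_of_nonneg fun _ _ => sq_nonneg _, ← ENNReal.ofReal_mul hv0,
      ENNReal.ofReal_rpow_of_nonneg hc two_pos.le]
    refine ENNReal.ofReal_le_ofReal ?_
    exact_mod_cast h
  simp only [ENNReal.toReal_ofNat]
  calc _ ≤ (ENNReal.ofReal c ^ (2 : ℝ)) ^ ((1 : ℝ) / 2) :=
        ENNReal.rpow_le_rpow (h1.trans h2) (by norm_num)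
    _ = ENNReal.ofReal c := by rw [← ENNReal.rpow_mul]; norm_num

end LTwo

/-! ### Rounding on the unit cube -/

section Cube

variable {d : ℕ}

theorem unitCube_eq_pi : unitCube d = Set.pi univ fun _ => Ioo (0 : ℝ) 1 := by
  ext x
  simp [unitCube]

theorem measurableSet_unitCube : MeasurableSet (unitCube d) := by
  rw [unitCube_eq_pi]
  exact MeasurableSet.univ_pi fun _ => measurableSet_Ioo

theorem measurable_roundDyadic (l : ℕ) : Measurable (roundDyadic l) := by
  unfold roundDyadic
  have : Measurable fun x : ℝ => ⌊2 ^ l * x⌋₊ := Nat.measurable_floor.comp (measurable_const_mul _)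
  exact (measurable_from_nat (f := fun k : ℕ => ((max k 1 : ℕ) : ℝ) / 2 ^ l)).comp this

/-- Coordinatewise rounding to dyadic points of level `l j`. -/
def roundGrid (l : Fin d → ℕ) (x : Fin d → ℝ) : Fin d → ℝ := fun j => roundDyadic (l j) (x j)

theorem measurable_roundGrid (l : Fin d → ℕ) : Measurable (roundGrid l) :=
  measurable_pi_lambda _ fun j => (measurable_roundDyadic _).comp (measurable_pi_apply j)

theorem roundGrid_mem (l : Fin d → ℕ) (hl : ∀ j, l j ≠ 0) {x : Fin d → ℝ} (hx : x ∈ unitCube d) :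
    roundGrid l x ∈ Fintype.piFinset fun j => dyadicGrid (l j) :=
  Fintype.mem_piFinset.2 fun j => roundDyadic_mem_dyadicGrid (hl j) (hx j).2

/-- Rounding moves each coordinate by at most `2^{-l}`. The factor `2` is needed at the first grid
point, which also absorbs the cell at the origin. -/
theorem volume_preimage_roundGrid_le (l : Fin d → ℕ) (y : Fin d → ℝ) :
    volume.restrict (unitCube d) (roundGrid l ⁻¹' {y}) ≤
      ENNReal.ofReal (∏ j, 2 / 2 ^ l j) := by
  rw [Measure.restrict_apply (measurable_roundGrid l (measurableSet_singleton y))]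
  refine (measure_mono (t := Icc (fun j => y j - 1 / 2 ^ l j) fun j => y j + 1 / 2 ^ l j)
    ?_).trans ?_
  · rintro x ⟨hx, hxc⟩
    have h1 : ∀ j, |x j - y j| ≤ 1 / 2 ^ l j := by
      intro j
      have h2 : y j = roundDyadic (l j) (x j) := (congrFun hx j).symm
      rw [h2]
      exact abs_sub_roundDyadic_le _ (hxc j).1.le
    exact ⟨fun j => by linarith [(abs_le.1 (h1 j)).1], fun j => by linarith [(abs_le.1 (h1 j)).2]⟩
  · rw [Real.volume_Icc_pi, ENNReal.ofReal_prod_of_nonneg fun _ _ => by positivity]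
    refine Finset.prod_le_prod' fun j _ => ENNReal.ofReal_le_ofReal (le_of_eq ?_)
    ring

theorem eLpNorm_comp_roundGrid_le (l : Fin d → ℕ) (hl : ∀ j, l j ≠ 0) (G : (Fin d → ℝ) → ℝ) {c : ℝ}
    (hc : 0 ≤ c)
    (h : (∏ j, (2 / 2 ^ l j : ℝ)) * ∑ y ∈ Fintype.piFinset fun j => dyadicGrid (l j), G y ^ 2 ≤
      c ^ 2) :
    eLpNorm (fun x => G (roundGrid l x)) 2 (volume.restrict (unitCube d)) ≤ ENNReal.ofReal c := by
  refine eLpNorm_two_comp_le (measurable_roundGrid l) ?_ (Finset.prod_nonneg fun _ _ => by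
    positivity) (fun y _ => volume_preimage_roundGrid_le l y) G hc h
  filter_upwards [self_mem_ae_restrict measurableSet_unitCube] with x hx
  exact roundGrid_mem l hl hx

theorem eLpNorm_comp_floor_le (L : ℕ) (G : (Fin d → ℕ) → ℝ) {c : ℝ} (hc : 0 ≤ c)
    (h : ((1 / 2 ^ L : ℝ) ^ d) * ∑ k : Fin d → Fin (2 ^ L), G (fun j => k j) ^ 2 ≤ c ^ 2) :
    eLpNorm (fun x => G fun j => ⌊2 ^ L * x j⌋₊) 2 (volume.restrict (unitCube d)) ≤
      ENNReal.ofReal c := by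
  have hP : Measurable fun (x : Fin d → ℝ) j => ⌊2 ^ L * x j⌋₊ :=
    measurable_pi_lambda _ fun j =>
      Nat.measurable_floor.comp ((measurable_const_mul _).comp (measurable_pi_apply j))
  refine eLpNorm_two_comp_le (P := fun (x : Fin d → ℝ) j => ⌊2 ^ L * x j⌋₊)
    (F := Fintype.piFinset fun _ => Finset.range (2 ^ L)) hP ?_
    (v := (1 / 2 ^ L : ℝ) ^ d) (by positivity) (fun k _ => ?_) G hc ?_
  · filter_upwards [self_mem_ae_restrict measurableSet_unitCube] with x hx
    rw [Fintype.mem_piFinset]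
    intro j
    rw [Finset.mem_range, Nat.floor_lt' (by positivity)]
    push_cast
    exact mul_lt_of_lt_one_right (by positivity) (hx j).2
  · rw [Measure.restrict_apply (hP (measurableSet_singleton k))]
    refine (measure_mono (t := Icc (fun j => (k j : ℝ) / 2 ^ L) fun j => ((k j : ℝ) + 1) / 2 ^ L)
      ?_).trans ?_
    · rintro x ⟨hx, hxc⟩
      have h2 : ∀ j, ⌊2 ^ L * x j⌋₊ = k j := fun j => congrFun hx j
      constructor <;> intro j
      · rw [div_le_iff₀ (by positivity), mul_comm, ← h2 j]
        exact Nat.floor_le (mul_nonneg (by positivity) (hxc j).1.le)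
      · rw [le_div_iff₀ (by positivity), mul_comm, ← h2 j]
        exact (Nat.lt_floor_add_one _).le
    · rw [Real.volume_Icc_pi, ENNReal.ofReal_pow (by positivity)]
      refine le_of_eq ?_
      rw [Finset.prod_congr rfl (g := fun _ => ENNReal.ofReal (1 / 2 ^ L)), Finset.prod_const,
        Finset.card_univ, Fintype.card_fin]
      intro j _
      congr 1
      ring
  · refine le_trans (le_of_eq ?_) h
    congr 1
    symm
    refine Finset.sum_nbij (fun k j => (k j : ℕ)) ?_ ?_ ?_ fun _ _ => rfl
    · exact fun k _ => Fintype.mem_piFinset.2 fun j => Finset.mem_range.2 (k j).2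
    · intro k _ k' _ hkk
      ext j
      exact congrFun hkk j
    · intro k hk
      have hk' := Fintype.mem_piFinset.1 (Finset.mem_coe.1 hk)
      exact ⟨fun j => ⟨k j, Finset.mem_range.1 (hk' j)⟩, by simp, rfl⟩

end Cube

/-! ### Multilinear combinations of interpolation operators -/

section Combination

variable {d : ℕ} {H : Type*} [NormedAddCommGroup H] [InnerProductSpace ℝ H]

/-- The `l`-th unit vector; zero for `l = 0`. -/
def levelVec (l : ℕ) : ℕ → ℝ := if l = 0 then 0 else Pi.single l 1

/-- The linear combination of the `f (roundDyadic a t)`, `a ≤ L`, with weights `u a`. -/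
def levelComb (L : ℕ) (f : ℝ → H) (t : ℝ) (u : ℕ → ℝ) : H :=
  ∑ a ∈ Finset.range (L + 1), u a • f (roundDyadic a t)

/-- The linear combination of the `e (roundGrid l x)`, `l ≤ L`, with weights `∏ j, u j (l j)`. -/
def gridComb (L : ℕ) (e : (Fin d → ℝ) → H) (x : Fin d → ℝ) :
    MultilinearMap ℝ (fun _ : Fin d => ℕ → ℝ) H :=
  ∑ l ∈ Fintype.piFinset fun _ : Fin d => Finset.range (L + 1),
    ((MultilinearMap.mkPiAlgebra ℝ (Fin d) ℝ).compLinearMap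
      fun j => LinearMap.proj (l j)).smulRight (e (roundGrid l x))

theorem gridComb_apply (L : ℕ) (e : (Fin d → ℝ) → H) (x : Fin d → ℝ) (u : Fin d → ℕ → ℝ) :
    gridComb L e x u = ∑ l ∈ Fintype.piFinset fun _ : Fin d => Finset.range (L + 1),
      (∏ j, u j (l j)) • e (roundGrid l x) := by
  simp [gridComb]

theorem gridComb_levelVec {L : ℕ} (e : (Fin d → ℝ) → H) (x : Fin d → ℝ) {l : Fin d → ℕ}
    (hl : ∀ j, l j ≠ 0) (hL : ∀ j, l j ≤ L) :
    gridComb L e x (fun j => levelVec (l j)) = e (roundGrid l x) := by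
  rw [gridComb_apply, Finset.sum_eq_single l]
  · simp [levelVec, hl]
  · intro k _ hk
    obtain ⟨j, hj⟩ := Function.ne_iff.1 hk
    rw [Finset.prod_eq_zero (Finset.mem_univ j), zero_smul]
    simp [levelVec, hl, hj]
  · intro h
    exact absurd (Fintype.mem_piFinset.2 fun j => Finset.mem_range.2 (Nat.lt_succ_of_le (hL j))) h

theorem gridComb_eq_zero {L : ℕ} (e : (Fin d → ℝ) → H) (x : Fin d → ℝ) {l : Fin d → ℕ}
    {j : Fin d} (hl : l j = 0) : gridComb L e x (fun j => levelVec (l j)) = 0 :=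
  MultilinearMap.map_coord_zero _ j (by simp [levelVec, hl])

theorem levelComb_levelVec {L m : ℕ} (hm : m ≤ L) (f : ℝ → H) (t : ℝ) (h : H) :
    inner ℝ (levelComb L f t (levelVec m)) h = levelEval m (fun x => inner ℝ (f x) h) t := by
  rw [levelComb, levelEval]
  split_ifs with h0
  · simp [levelVec, h0]
  · rw [Finset.sum_eq_single m]
    · simp [levelVec, h0]
    · intro a _ ha
      simp [levelVec, h0, ha]
    · intro h
      exact absurd (Finset.mem_range.2 (Nat.lt_succ_of_le hm)) h

theorem levelComb_sub (L : ℕ) (f : ℝ → H) (t : ℝ) (u v : ℕ → ℝ) :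
    levelComb L f t (u - v) = levelComb L f t u - levelComb L f t v := by
  simp [levelComb, sub_smul]

theorem gridComb_floor (L : ℕ) (e : (Fin d → ℝ) → H) (x : Fin d → ℝ) :
    gridComb L e (fun j => (⌊2 ^ L * x j⌋₊ : ℝ) / 2 ^ L) = gridComb L e x := by
  ext u
  rw [gridComb_apply, gridComb_apply]
  refine Finset.sum_congr rfl fun l hl => ?_
  congr 2
  funext j
  exact roundDyadic_floor
    (Nat.lt_succ_iff.1 (Finset.mem_range.1 (Fintype.mem_piFinset.1 hl j))) _

variable {E : Fin d → Type*} [∀ j, NormedAddCommGroup (E j)] [∀ j, InnerProductSpace ℝ (E j)]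
  {e : (Fin d → ℝ) → H} {e₁ : ∀ j, ℝ → E j}

theorem inner_gridComb (he : ∀ x y, inner ℝ (e x) (e y) = ∏ j, inner ℝ (e₁ j (x j)) (e₁ j (y j)))
    (L : ℕ) (x y : Fin d → ℝ) (u : Fin d → ℕ → ℝ) :
    inner ℝ (gridComb L e x u) (gridComb L e y u) =
      ∏ j, inner ℝ (levelComb L (e₁ j) (x j) (u j)) (levelComb L (e₁ j) (y j) (u j)) := by
  simp only [gridComb_apply, levelComb, sum_inner, inner_sum, real_inner_smul_left,
    real_inner_smul_right, he]
  rw [Finset.prod_univ_sum]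
  refine Finset.sum_congr rfl fun l _ => ?_
  rw [Finset.prod_univ_sum]
  refine Finset.sum_congr rfl fun l' _ => ?_
  rw [← Finset.prod_mul_distrib, ← Finset.prod_mul_distrib]
  rfl

/-- The combination depends on `x` only through its level-`L` cell, so its `L²` norm is a normalised
sum over the `2^{Ld}` cells. That sum is a Bessel sum for vectors whose Gram matrix factorises, so
the one-dimensional bounds multiply. -/
theorem eLpNorm_inner_gridComb_sub_le
    (he : ∀ x y, inner ℝ (e x) (e y) = ∏ j, inner ℝ (e₁ j (x j)) (e₁ j (y j)))
    {B : Fin d → ℝ} (hB0 : ∀ j, 0 ≤ B j)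
    (hB : ∀ j (h : E j) (n m L : ℕ), n ≤ m → m ≤ L →
      ∑ c ∈ Finset.range (2 ^ L),
        (levelEval m (fun x => inner ℝ (e₁ j x) h) ((c : ℝ) / 2 ^ L) -
          levelEval n (fun x => inner ℝ (e₁ j x) h) ((c : ℝ) / 2 ^ L)) ^ 2
        ≤ 2 ^ L * (((1 / 2 ^ n) * B j) ^ 2 * ‖h‖ ^ 2))
    (h : H) {n m : Fin d → ℕ} {L : ℕ} (hnm : ∀ j, n j ≤ m j) (hmL : ∀ j, m j ≤ L) :
    eLpNorm (fun x => inner ℝ (gridComb L e x fun j => levelVec (m j) - levelVec (n j)) h) 2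
      (volume.restrict (unitCube d)) ≤
      ENNReal.ofReal ((∏ j, 1 / 2 ^ n j * B j) * ‖h‖) := by
  set u : Fin d → ℕ → ℝ := fun j => levelVec (m j) - levelVec (n j) with hu
  have hprod : 0 ≤ ∏ j, 1 / 2 ^ n j * B j :=
    Finset.prod_nonneg fun j _ => mul_nonneg (by positivity) (hB0 j)
  have key := sum_inner_sq_le_prod (ι := Fin (2 ^ L))
    (fun j c => levelComb L (e₁ j) (((c : ℕ) : ℝ) / 2 ^ L) (u j))
    (fun j => 2 ^ L * ((1 / 2 ^ n j) * B j) ^ 2) (fun j => by positivity)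
    (fun j g => by
      have := hB j g (n j) (m j) L (hnm j) (hmL j)
      rw [Finset.sum_range] at this
      simp only [hu, levelComb_sub, inner_sub_left, levelComb_levelVec (hmL j),
        levelComb_levelVec ((hnm j).trans (hmL j))]
      linarith)
    (fun c => gridComb L e (fun j => ((c j : ℕ) : ℝ) / 2 ^ L) u)
    (fun c c' => inner_gridComb he L _ _ u) h
  set G : (Fin d → ℕ) → ℝ :=
    fun k => inner ℝ (gridComb L e (fun j => (k j : ℝ) / 2 ^ L) u) h with hG
  have heq : ∀ x, inner ℝ (gridComb L e x u) h = G fun j => ⌊2 ^ L * x j⌋₊ := fun x => by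
    rw [← gridComb_floor]
  simp_rw [heq]
  refine eLpNorm_comp_floor_le L G (mul_nonneg hprod (norm_nonneg h)) ?_
  have hscale : (1 / 2 ^ L : ℝ) ^ d * ∏ j, (2 ^ L * (1 / 2 ^ n j * B j) ^ 2) =
      (∏ j, 1 / 2 ^ n j * B j) ^ 2 := by
    rw [Finset.prod_mul_distrib, Finset.prod_const, Finset.card_univ, Fintype.card_fin,
      Finset.prod_pow, ← mul_assoc, ← mul_pow, one_div_mul_cancel (by positivity), one_pow,
      one_mul]
  rw [mul_pow, ← hscale, mul_assoc]
  exact mul_le_mul_of_nonneg_left key (by positivity)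

end Combination

/-! ### Sums over levels and cardinality of sparse grids -/

section Counting

theorem sum_piFinset_succ {M : Type*} [AddCommMonoid M] (D : ℕ) (S : Finset ℕ)
    (φ : (Fin (D + 1) → ℕ) → M) :
    ∑ ρ ∈ Fintype.piFinset fun _ => S, φ ρ =
      ∑ a ∈ S, ∑ ρ ∈ Fintype.piFinset fun _ : Fin D => S, φ (Fin.cons a ρ) := by
  rw [← Finset.sum_product']
  refine Finset.sum_nbij' (fun ρ => (ρ 0, Fin.tail ρ)) (fun z => Fin.cons z.1 z.2) ?_ ?_ ?_ ?_ ?_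
  · intro ρ hρ
    rw [Fintype.mem_piFinset] at hρ
    exact Finset.mem_product.2 ⟨hρ 0, Fintype.mem_piFinset.2 fun j => hρ j.succ⟩
  · rintro ⟨a, ρ⟩ h
    rw [Finset.mem_product, Fintype.mem_piFinset] at h
    rw [Fintype.mem_piFinset]
    exact Fin.cases h.1 h.2
  · intro ρ _
    exact Fin.cons_self_tail ρ
  · rintro ⟨a, ρ⟩ _
    simp
  · intro ρ _
    simp

/-- Peeling off one coordinate `a` replaces `τ` by `τ - a`. The remaining sum over `a` has `τ` equal
terms and a geometric tail, costing a factor `2(τ + 1)`. -/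
theorem sum_inv_two_pow_max_le (D L τ : ℕ) :
    ∑ ρ ∈ Fintype.piFinset fun _ : Fin D => Finset.range L,
      (1 / 2 : ℝ) ^ (max (∑ j, ρ j) τ) ≤ 2 ^ D * ((τ : ℝ) + 1) ^ D * (1 / 2) ^ τ := by
  induction D generalizing τ with
  | zero => simp
  | succ D ih =>
    rw [sum_piFinset_succ]
    have hstep : ∀ a, ∑ ρ ∈ Fintype.piFinset fun _ : Fin D => Finset.range L,
        (1 / 2 : ℝ) ^ (max (∑ j, (Fin.cons a ρ : Fin (D + 1) → ℕ) j) τ) ≤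
        2 ^ D * ((τ : ℝ) + 1) ^ D * (1 / 2) ^ (max a τ) := by
      intro a
      have h1 : ∀ ρ : Fin D → ℕ, (1 / 2 : ℝ) ^ (max (∑ j, (Fin.cons a ρ : Fin (D + 1) → ℕ) j) τ) =
          (1 / 2) ^ a * (1 / 2) ^ (max (∑ j, ρ j) (τ - a)) := by
        intro ρ
        rw [← pow_add, Fin.sum_univ_succ]
        simp only [Fin.cons_zero, Fin.cons_succ]
        congr 1
        omega
      simp_rw [h1]
      rw [← Finset.mul_sum]
      have h2 : (((τ - a : ℕ) : ℝ) + 1) ≤ (τ : ℝ) + 1 := by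
        gcongr
        omega
      calc _ ≤ (1 / 2 : ℝ) ^ a * (2 ^ D * (((τ - a : ℕ) : ℝ) + 1) ^ D * (1 / 2) ^ (τ - a)) := by
            gcongr
            exact ih _
        _ ≤ (1 / 2 : ℝ) ^ a * (2 ^ D * ((τ : ℝ) + 1) ^ D * (1 / 2) ^ (τ - a)) := by
            gcongr
        _ = 2 ^ D * ((τ : ℝ) + 1) ^ D * ((1 / 2) ^ a * (1 / 2) ^ (τ - a)) := by ring
        _ = _ := by
            rw [← pow_add]
            congr 2
            omega
    have hgeom : ∑ a ∈ Finset.range L, (1 / 2 : ℝ) ^ (max a τ) ≤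
        2 * ((τ : ℝ) + 1) * (1 / 2) ^ τ := by
      have hL : ∑ a ∈ Finset.range L, (1 / 2 : ℝ) ^ (max a τ) ≤
          ∑ a ∈ Finset.range (τ + L), (1 / 2 : ℝ) ^ (max a τ) :=
        Finset.sum_le_sum_of_subset_of_nonneg (Finset.range_mono (Nat.le_add_left _ _))
          fun _ _ _ => by positivity
      refine hL.trans ?_
      rw [Finset.sum_range_add]
      have h1 : ∑ a ∈ Finset.range τ, (1 / 2 : ℝ) ^ (max a τ) = τ * (1 / 2) ^ τ := by
        rw [Finset.sum_congr rfl (g := fun _ => (1 / 2 : ℝ) ^ τ)]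
        · simp
        · intro a ha
          rw [max_eq_right (Finset.mem_range.1 ha).le]
      have h2 : ∑ a ∈ Finset.range L, (1 / 2 : ℝ) ^ (max (τ + a) τ) ≤ 2 * (1 / 2) ^ τ := by
        have h3 : ∀ a, (1 / 2 : ℝ) ^ (max (τ + a) τ) = (1 / 2) ^ τ * (1 / 2) ^ a := by
          intro a
          rw [max_eq_left (Nat.le_add_right _ _), pow_add]
        simp_rw [h3]
        rw [← Finset.mul_sum, mul_comm]
        gcongr
        have h4 := Summable.sum_le_tsum (Finset.range L) (fun i _ => by positivity)
          summable_geometric_two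
        rwa [tsum_geometric_two] at h4
      rw [h1]
      have h5 : 0 ≤ (τ : ℝ) * (1 / 2) ^ τ := by positivity
      linarith
    calc _ ≤ ∑ a ∈ Finset.range L, 2 ^ D * ((τ : ℝ) + 1) ^ D * (1 / 2) ^ (max a τ) :=
          Finset.sum_le_sum fun a _ => hstep a
      _ ≤ 2 ^ D * ((τ : ℝ) + 1) ^ D * (2 * ((τ : ℝ) + 1) * (1 / 2) ^ τ) := by
          rw [← Finset.mul_sum]
          gcongr
      _ = _ := by ring

theorem card_filter_sum_lt_le (D L τ : ℕ) :
    ((Fintype.piFinset fun _ : Fin D => Finset.range L).filter fun ρ => ∑ j, ρ j < τ).card ≤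
      τ ^ D := by
  calc _ ≤ (Fintype.piFinset fun _ : Fin D => Finset.range τ).card := by
        refine Finset.card_le_card fun ρ hρ => ?_
        rw [Finset.mem_filter] at hρ
        refine Fintype.mem_piFinset.2 fun j => Finset.mem_range.2 ?_
        exact (Finset.single_le_sum (fun _ _ => Nat.zero_le _) (Finset.mem_univ j)).trans_lt hρ.2
    _ = τ ^ D := by simp

theorem card_dyadicGrid_le (l : ℕ) : (dyadicGrid l).card ≤ 2 ^ l := by
  refine Finset.card_image_le.trans ?_
  rw [Nat.card_Icc]
  have := Nat.one_le_two_pow (n := l)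
  omega

/-- With the last `D` levels fixed, the sizes of the full grids are bounded by distinct powers of
two, none above `2^{τ+D}`, so they sum to less than `2^{τ+D+1}`. -/
theorem card_sparseGrid_le (D τ : ℕ) :
    (sparseGrid (D + 1) τ).card ≤ (τ + D) ^ D * 2 ^ (τ + D + 1) := by
  set N := τ + (D + 1) - 1 with hN
  have hN' : N = τ + D := by omega
  have h1 : (sparseGrid (D + 1) τ).card ≤
      ∑ l ∈ (Fintype.piFinset fun _ : Fin (D + 1) => Finset.Icc 1 N).filter
        (fun l => ∑ j, l j ≤ N), 2 ^ ∑ j, l j := by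
    refine Finset.card_biUnion_le.trans ?_
    refine (Finset.sum_le_sum (g := fun l : Fin (D + 1) → ℕ => 2 ^ ∑ j, l j)
      fun l _ => ?_).trans (le_of_eq ?_)
    · rw [Fintype.card_piFinset, ← Finset.prod_pow_eq_pow_sum]
      exact Finset.prod_le_prod' fun j _ => card_dyadicGrid_le _
    · congr!
  refine h1.trans ?_
  rw [Finset.sum_filter, sum_piFinset_succ, Finset.sum_comm]
  have h2 : ∀ ρ ∈ Fintype.piFinset fun _ : Fin D => Finset.Icc 1 N,
      ∑ a ∈ Finset.Icc 1 N, (if ∑ j, (Fin.cons a ρ : Fin (D + 1) → ℕ) j ≤ N then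
        2 ^ ∑ j, (Fin.cons a ρ : Fin (D + 1) → ℕ) j else 0) ≤ 2 ^ (N + 1) := by
    intro ρ _
    simp only [Fin.sum_univ_succ, Fin.cons_zero, Fin.cons_succ]
    rw [← Finset.sum_filter]
    set s := ∑ j, ρ j
    rw [← Finset.sum_image (f := fun b => 2 ^ b) (g := fun a => a + s)
      (fun a _ b _ h => Nat.add_right_cancel h)]
    refine (Nat.geomSum_lt le_rfl fun b hb => ?_).le
    obtain ⟨a, ha, rfl⟩ := Finset.mem_image.1 hb
    exact Nat.lt_succ_of_le (Finset.mem_filter.1 ha).2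
  refine (Finset.sum_le_sum h2).trans (le_of_eq ?_)
  rw [Finset.sum_const, Fintype.card_piFinset]
  simp [hN']

theorem card_sparseGrid_succ_le (D : ℕ) {τ : ℕ} (hτ : 1 ≤ τ) :
    (sparseGrid (D + 1) (τ + 1)).card ≤ (D + 2) ^ D * 2 ^ (D + 2) * (τ ^ D * 2 ^ τ) := by
  refine (card_sparseGrid_le D (τ + 1)).trans ?_
  have h1 : τ + 1 + D ≤ (D + 2) * τ := by nlinarith
  calc (τ + 1 + D) ^ D * 2 ^ (τ + 1 + D + 1) ≤ ((D + 2) * τ) ^ D * 2 ^ (τ + 1 + D + 1) := by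
        gcongr
    _ = _ := by
        rw [mul_pow, show τ + 1 + D + 1 = (D + 2) + τ by ring, pow_add]
        ring

/-- The sparse grid contains the full grid of levels `(τ, 1, …, 1)`. -/
theorem two_pow_le_card_sparseGrid (D : ℕ) {τ : ℕ} (hτ : 1 ≤ τ) :
    2 ^ τ - 1 ≤ (sparseGrid (D + 1) τ).card := by
  classical
  have hsub : (Fintype.piFinset fun j => dyadicGrid ((Fin.cons τ fun _ => 1 : Fin (D + 1) → ℕ) j)) ⊆
      sparseGrid (D + 1) τ := by
    refine Finset.subset_biUnion_of_mem (fun l : Fin (D + 1) → ℕ =>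
      Fintype.piFinset fun j => dyadicGrid (l j)) (Finset.mem_filter.2 ⟨?_, ?_⟩)
    · refine Fintype.mem_piFinset.2 fun j => Finset.mem_Icc.2 ?_
      refine Fin.cases ?_ (fun j => ?_) j
      · simp only [Fin.cons_zero]
        omega
      · simp only [Fin.cons_succ]
        omega
    · rw [Fin.sum_univ_succ]
      simp
  have hcard : ∀ l, (dyadicGrid l).card = 2 ^ l - 1 := by
    intro l
    rw [dyadicGrid, Finset.card_image_of_injective]
    · simp
    · intro i j h
      have h' : (i : ℝ) / 2 ^ l = j / 2 ^ l := h
      rw [div_left_inj' (by positivity)] at h'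
      exact_mod_cast h'
  refine le_trans (le_of_eq ?_) (Finset.card_le_card hsub)
  rw [Fintype.card_piFinset, Fin.prod_univ_succ]
  simp [hcard]

end Counting

/-! ### The telescoping decomposition -/

section Telescoping

variable {D : ℕ} {H : Type*} [NormedAddCommGroup H] [InnerProductSpace ℝ H]

theorem levelVec_eq_sum (L : ℕ) :
    levelVec L = ∑ r ∈ Finset.range L, (levelVec (r + 1) - levelVec r) := by
  rw [Finset.sum_range_sub]
  simp [levelVec]

theorem levelVec_sub_eq_sum (r : ℕ) : levelVec (r + 1) - levelVec r =
    ∑ b : Fin 2, (if b = 0 then (-1 : ℝ) else 1) • levelVec (r + (b : ℕ)) := by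
  rw [Fin.sum_univ_two]
  simp [sub_eq_neg_add]

/-- The first summand carries the approximation error and the second samples only the sparse grid.
Truncated subtraction makes the second vanish when `|ρ| ≥ τ`, since `levelVec 0 = 0`. -/
theorem gridComb_levelVec_eq_sum (L τ : ℕ) (e : (Fin (D + 1) → ℝ) → H) (x : Fin (D + 1) → ℝ) :
    gridComb L e x (fun _ => levelVec L) =
      ∑ ρ ∈ Fintype.piFinset fun _ : Fin D => Finset.range L,
        (gridComb L e x (fun j => levelVec ((Fin.cons L fun i => ρ i + 1 : Fin (D + 1) → ℕ) j) -
            levelVec ((Fin.cons (τ - ∑ i, ρ i) ρ : Fin (D + 1) → ℕ) j)) +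
          ∑ ε : Fin D → Fin 2, (∏ i, if ε i = 0 then (-1 : ℝ) else 1) •
            gridComb L e x (fun j => levelVec
              ((Fin.cons (τ - ∑ i, ρ i) fun i => ρ i + (ε i : ℕ) : Fin (D + 1) → ℕ) j))) := by
  set S := gridComb L e x
  have hcons : (fun _ : Fin (D + 1) => levelVec L) =
      Fin.cons (levelVec L) fun _ => ∑ r ∈ Finset.range L, (levelVec (r + 1) - levelVec r) := by
    funext j
    refine Fin.cases rfl (fun i => ?_) j
    rw [Fin.cons_succ, ← levelVec_eq_sum]
  rw [hcons, ← MultilinearMap.curryLeft_apply, MultilinearMap.map_sum_finset]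
  refine Finset.sum_congr rfl fun ρ _ => ?_
  set m := τ - ∑ i, ρ i
  have h1 : (fun j => levelVec ((Fin.cons L fun i => ρ i + 1 : Fin (D + 1) → ℕ) j) -
      levelVec ((Fin.cons m ρ : Fin (D + 1) → ℕ) j)) =
      Fin.cons (levelVec L - levelVec m) fun i => levelVec (ρ i + 1) - levelVec (ρ i) := by
    funext j
    exact Fin.cases rfl (fun i => rfl) j
  have h2 : ∀ ε : Fin D → Fin 2, (fun j => levelVec
      ((Fin.cons m fun i => ρ i + (ε i : ℕ) : Fin (D + 1) → ℕ) j)) =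
      Fin.cons (levelVec m) fun i => levelVec (ρ i + (ε i : ℕ)) := by
    intro ε
    funext j
    exact Fin.cases rfl (fun i => rfl) j
  have h3 : S.curryLeft (levelVec m) (fun i => levelVec (ρ i + 1) - levelVec (ρ i)) =
      ∑ ε : Fin D → Fin 2, (∏ i, if ε i = 0 then (-1 : ℝ) else 1) •
        S.curryLeft (levelVec m) (fun i => levelVec (ρ i + (ε i : ℕ))) := by
    simp_rw [levelVec_sub_eq_sum]
    rw [MultilinearMap.map_sum]
    refine Finset.sum_congr rfl fun ε _ => ?_
    rw [MultilinearMap.map_smul_univ]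
  simp_rw [h1, h2, ← MultilinearMap.curryLeft_apply]
  rw [← h3, ← add_apply, ← map_add, sub_add_cancel]

end Telescoping

/-! ### The `L²` estimate in terms of the level -/

section Estimate

variable {D : ℕ} {H : Type*} [NormedAddCommGroup H] [InnerProductSpace ℝ H]
  {e : (Fin (D + 1) → ℝ) → H}

theorem measurable_inner_gridComb {d : ℕ} (L : ℕ) (e : (Fin d → ℝ) → H) (u : Fin d → ℕ → ℝ)
    (h : H) : Measurable fun x => inner ℝ (gridComb L e x u) h := by
  have hP : Measurable fun (x : Fin d → ℝ) j => ⌊2 ^ L * x j⌋₊ :=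
    measurable_pi_lambda _ fun j =>
      Nat.measurable_floor.comp ((measurable_const_mul _).comp (measurable_pi_apply j))
  have hG : Measurable fun k : Fin d → ℕ =>
      inner ℝ (gridComb L e (fun j => (k j : ℝ) / 2 ^ L) u) h := Measurable.of_discrete
  have heq : (fun x => inner ℝ (gridComb L e x u) h) = (fun k : Fin d → ℕ =>
      inner ℝ (gridComb L e (fun j => (k j : ℝ) / 2 ^ L) u) h) ∘ fun x j => ⌊2 ^ L * x j⌋₊ :=
    funext fun x => (congrArg (fun S => inner ℝ (S u) h) (gridComb_floor L e x)).symm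
  rw [heq]
  exact hG.comp hP

theorem piFinset_dyadicGrid_subset_sparseGrid {τ : ℕ} {l : Fin (D + 1) → ℕ} (hl : ∀ j, l j ≠ 0)
    (hsum : ∑ j, l j ≤ τ + D) :
    (Fintype.piFinset fun j => dyadicGrid (l j)) ⊆ sparseGrid (D + 1) τ := by
  classical
  refine Finset.subset_biUnion_of_mem (fun l : Fin (D + 1) → ℕ =>
    Fintype.piFinset fun j => dyadicGrid (l j)) (Finset.mem_filter.2 ⟨?_, hsum⟩)
  exact Fintype.mem_piFinset.2 fun j => Finset.mem_Icc.2 ⟨Nat.one_le_iff_ne_zero.2 (hl j),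
    (Finset.single_le_sum (fun _ _ => Nat.zero_le _) (Finset.mem_univ j)).trans hsum⟩

/-- The lower bound on the level sum makes the cells small, and the upper bound keeps the sample
points in the sparse grid. A level equal to zero annihilates the product. -/
theorem eLpNorm_inner_gridComb_levelVec_le (e : (Fin (D + 1) → ℝ) → H) (h : H) {τ L : ℕ}
    (hL : τ + D ≤ L) {l : Fin (D + 1) → ℕ} (hlow : τ ≤ ∑ j, l j) (hup : ∑ j, l j ≤ τ + D) :
    eLpNorm (fun x => inner ℝ (gridComb L e x fun j => levelVec (l j)) h) 2
        (volume.restrict (unitCube (D + 1))) ≤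
      ENNReal.ofReal (√(2 ^ (D + 1) * (1 / 2) ^ τ *
        ∑ y ∈ sparseGrid (D + 1) τ, inner ℝ (e y) h ^ 2)) := by
  by_cases hl : ∀ j, l j ≠ 0
  · have h1 : ∀ j, l j ≤ L := fun j =>
      ((Finset.single_le_sum (fun _ _ => Nat.zero_le _) (Finset.mem_univ j)).trans hup).trans hL
    simp_rw [gridComb_levelVec e _ hl h1]
    refine eLpNorm_comp_roundGrid_le l hl (fun y => inner ℝ (e y) h) (Real.sqrt_nonneg _) ?_
    rw [Real.sq_sqrt (mul_nonneg (by positivity) (Finset.sum_nonneg fun _ _ => sq_nonneg _))]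
    refine mul_le_mul ?_ (Finset.sum_le_sum_of_subset_of_nonneg
      (piFinset_dyadicGrid_subset_sparseGrid hl hup) fun _ _ _ => sq_nonneg _)
      (Finset.sum_nonneg fun _ _ => sq_nonneg _) (by positivity)
    rw [Finset.prod_div_distrib, Finset.prod_const, Finset.card_univ, Fintype.card_fin,
      Finset.prod_pow_eq_pow_sum, div_eq_mul_one_div, ← one_div_pow]
    exact mul_le_mul_of_nonneg_left (pow_le_pow_of_le_one (by norm_num) (by norm_num) hlow)
      (by positivity)
  · push Not at hl
    obtain ⟨j, hj⟩ := hl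
    simp_rw [gridComb_eq_zero e _ hj, inner_zero_left]
    simp

theorem eLpNorm_inner_sum_gridComb_le (e : (Fin (D + 1) → ℝ) → H) (h : H) {τ L : ℕ}
    (hL : τ + D ≤ L) (ρ : Fin D → ℕ) :
    eLpNorm (fun x => inner ℝ (∑ ε : Fin D → Fin 2, (∏ i, if ε i = 0 then (-1 : ℝ) else 1) •
        gridComb L e x (fun j => levelVec
          ((Fin.cons (τ - ∑ i, ρ i) fun i => ρ i + (ε i : ℕ) : Fin (D + 1) → ℕ) j))) h) 2
        (volume.restrict (unitCube (D + 1))) ≤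
      if ∑ i, ρ i < τ then 2 ^ D * ENNReal.ofReal (√(2 ^ (D + 1) * (1 / 2) ^ τ *
        ∑ y ∈ sparseGrid (D + 1) τ, inner ℝ (e y) h ^ 2)) else 0 := by
  split_ifs with hlt
  · set G : (Fin D → Fin 2) → (Fin (D + 1) → ℝ) → ℝ := fun ε x => inner ℝ (gridComb L e x
      (fun j => levelVec
        ((Fin.cons (τ - ∑ i, ρ i) fun i => ρ i + (ε i : ℕ) : Fin (D + 1) → ℕ) j))) h with hG
    set s : (Fin D → Fin 2) → ℝ := fun ε => ∏ i, if ε i = 0 then (-1 : ℝ) else 1 with hs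
    have hsign : ∀ ε, ‖s ε‖ₑ = 1 := by
      intro ε
      have h1 : ‖s ε‖ = 1 := by
        rw [hs, norm_prod]
        refine Finset.prod_eq_one fun i _ => ?_
        split_ifs <;> simp
      rw [← ofReal_norm, h1, ENNReal.ofReal_one]
    have hsum : (fun x => inner ℝ (∑ ε : Fin D → Fin 2, s ε •
        gridComb L e x (fun j => levelVec
          ((Fin.cons (τ - ∑ i, ρ i) fun i => ρ i + (ε i : ℕ) : Fin (D + 1) → ℕ) j))) h) =
        ∑ ε, s ε • G ε := by
      funext x
      rw [sum_inner, Finset.sum_apply]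
      refine Finset.sum_congr rfl fun ε _ => ?_
      rw [real_inner_smul_left, Pi.smul_apply, smul_eq_mul]
    have hbound : ∀ ε, eLpNorm (s ε • G ε) 2 (volume.restrict (unitCube (D + 1))) ≤
        ENNReal.ofReal (√(2 ^ (D + 1) * (1 / 2) ^ τ *
          ∑ y ∈ sparseGrid (D + 1) τ, inner ℝ (e y) h ^ 2)) := by
      intro ε
      rw [eLpNorm_const_smul, hsign, one_mul]
      have hε : ∑ i, (ε i : ℕ) ≤ D := by
        refine (Finset.sum_le_card_nsmul Finset.univ (fun i => (ε i : ℕ)) 1 fun i _ => ?_).trans ?_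
        · have := (ε i).2
          omega
        · simp
      have hsum : ∑ j, (Fin.cons (τ - ∑ i, ρ i) fun i => ρ i + (ε i : ℕ) : Fin (D + 1) → ℕ) j =
          τ + ∑ i, (ε i : ℕ) := by
        rw [Fin.sum_univ_succ]
        simp only [Fin.cons_zero, Fin.cons_succ]
        rw [Finset.sum_add_distrib]
        omega
      exact eLpNorm_inner_gridComb_levelVec_le e h hL (by rw [hsum]; omega) (by rw [hsum]; omega)
    rw [hsum]
    refine (eLpNorm_sum_le (fun ε _ => ((measurable_inner_gridComb L e _ h).const_smul
      (s ε)).aestronglyMeasurable) one_le_two).trans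
        ((Finset.sum_le_sum fun ε _ => hbound ε).trans (le_of_eq ?_))
    rw [Finset.sum_const, nsmul_eq_mul, Finset.card_univ, Fintype.card_fun, Fintype.card_fin,
      Fintype.card_fin]
    norm_cast
  · have h3 : ∀ ε : Fin D → Fin 2,
        (Fin.cons (τ - ∑ i, ρ i) fun i => ρ i + (ε i : ℕ) : Fin (D + 1) → ℕ) 0 = 0 := by
      intro ε
      rw [Fin.cons_zero]
      omega
    have h4 : ∀ x, inner ℝ (∑ ε : Fin D → Fin 2, (∏ i, if ε i = 0 then (-1 : ℝ) else 1) •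
        gridComb L e x (fun j => levelVec
          ((Fin.cons (τ - ∑ i, ρ i) fun i => ρ i + (ε i : ℕ) : Fin (D + 1) → ℕ) j))) h = 0 := by
      intro x
      rw [Finset.sum_eq_zero, inner_zero_left]
      intro ε _
      rw [gridComb_eq_zero e x (h3 ε), smul_zero]
    simp_rw [h4]
    simp

variable {E : Fin (D + 1) → Type*} [∀ j, NormedAddCommGroup (E j)]
  [∀ j, InnerProductSpace ℝ (E j)] {e₁ : ∀ j, ℝ → E j}

theorem eLpNorm_inner_gridComb_cons_sub_le
    (he : ∀ x y, inner ℝ (e x) (e y) = ∏ j, inner ℝ (e₁ j (x j)) (e₁ j (y j)))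
    {B : Fin (D + 1) → ℝ} (hB0 : ∀ j, 0 ≤ B j)
    (hB : ∀ j (h : E j) (n m L : ℕ), n ≤ m → m ≤ L →
      ∑ c ∈ Finset.range (2 ^ L),
        (levelEval m (fun x => inner ℝ (e₁ j x) h) ((c : ℝ) / 2 ^ L) -
          levelEval n (fun x => inner ℝ (e₁ j x) h) ((c : ℝ) / 2 ^ L)) ^ 2
        ≤ 2 ^ L * (((1 / 2 ^ n) * B j) ^ 2 * ‖h‖ ^ 2))
    (h : H) {τ L : ℕ} (hL : τ ≤ L) {ρ : Fin D → ℕ} (hρ : ∀ i, ρ i < L) :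
    eLpNorm (fun x => inner ℝ (gridComb L e x
      (fun j => levelVec ((Fin.cons L fun i => ρ i + 1 : Fin (D + 1) → ℕ) j) -
        levelVec ((Fin.cons (τ - ∑ i, ρ i) ρ : Fin (D + 1) → ℕ) j))) h) 2
      (volume.restrict (unitCube (D + 1))) ≤
      ENNReal.ofReal ((∏ j, B j) * ‖h‖ * (1 / 2) ^ (max (∑ i, ρ i) τ)) := by
  refine (eLpNorm_inner_gridComb_sub_le he hB0 hB h
    (n := Fin.cons (τ - ∑ i, ρ i) ρ) (m := Fin.cons L fun i => ρ i + 1) ?_ ?_).trans ?_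
  · refine Fin.cases ?_ fun i => ?_
    · simp only [Fin.cons_zero]
      omega
    · simp only [Fin.cons_succ]
      omega
  · refine Fin.cases ?_ fun i => ?_
    · simp only [Fin.cons_zero]
      omega
    · simp only [Fin.cons_succ]
      exact hρ i
  · refine ENNReal.ofReal_le_ofReal (le_of_eq ?_)
    simp_rw [← one_div_pow]
    rw [Finset.prod_mul_distrib, Finset.prod_pow_eq_pow_sum, Fin.sum_univ_succ]
    simp only [Fin.cons_zero, Fin.cons_succ]
    -- The coarse levels of the differences sum to `max(|ρ|, τ)`, by truncated subtraction.
    rw [show τ - ∑ i, ρ i + ∑ i, ρ i = max (∑ i, ρ i) τ by omega]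
    ring

theorem eLpNorm_inner_roundGrid_le
    (he : ∀ x y, inner ℝ (e x) (e y) = ∏ j, inner ℝ (e₁ j (x j)) (e₁ j (y j)))
    {B : Fin (D + 1) → ℝ} (hB0 : ∀ j, 0 ≤ B j)
    (hB : ∀ j (h : E j) (n m L : ℕ), n ≤ m → m ≤ L →
      ∑ c ∈ Finset.range (2 ^ L),
        (levelEval m (fun x => inner ℝ (e₁ j x) h) ((c : ℝ) / 2 ^ L) -
          levelEval n (fun x => inner ℝ (e₁ j x) h) ((c : ℝ) / 2 ^ L)) ^ 2
        ≤ 2 ^ L * (((1 / 2 ^ n) * B j) ^ 2 * ‖h‖ ^ 2))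
    (h : H) {τ L : ℕ} (hτ : 1 ≤ τ) (hL : τ + D ≤ L) :
    eLpNorm (fun x => inner ℝ (e (roundGrid (fun _ => L) x)) h) 2
        (volume.restrict (unitCube (D + 1))) ≤
      ENNReal.ofReal ((∏ j, B j) * ‖h‖ * (2 ^ D * ((τ : ℝ) + 1) ^ D * (1 / 2) ^ τ) +
        (τ : ℝ) ^ D * 2 ^ D * √(2 ^ (D + 1) * (1 / 2) ^ τ *
          ∑ y ∈ sparseGrid (D + 1) τ, inner ℝ (e y) h ^ 2)) := by
  set μ := volume.restrict (unitCube (D + 1)) with hμ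
  set R := Fintype.piFinset fun _ : Fin D => Finset.range L with hR
  set q := √(2 ^ (D + 1) * (1 / 2) ^ τ * ∑ y ∈ sparseGrid (D + 1) τ, inner ℝ (e y) h ^ 2) with hq
  have hq0 : 0 ≤ q := Real.sqrt_nonneg _
  have hBp : 0 ≤ ∏ j, B j := Finset.prod_nonneg fun j _ => hB0 j
  set F₁ : (Fin D → ℕ) → (Fin (D + 1) → ℝ) → ℝ := fun ρ x => inner ℝ (gridComb L e x
    (fun j => levelVec ((Fin.cons L fun i => ρ i + 1 : Fin (D + 1) → ℕ) j) -
            levelVec ((Fin.cons (τ - ∑ i, ρ i) ρ : Fin (D + 1) → ℕ) j))) h with hF₁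
  set F₂ : (Fin D → ℕ) → (Fin (D + 1) → ℝ) → ℝ := fun ρ x => inner ℝ
    (∑ ε : Fin D → Fin 2, (∏ i, if ε i = 0 then (-1 : ℝ) else 1) •
        gridComb L e x (fun j => levelVec
          ((Fin.cons (τ - ∑ i, ρ i) fun i => ρ i + (ε i : ℕ) : Fin (D + 1) → ℕ) j))) h with hF₂
  have hm₁ : ∀ ρ, AEStronglyMeasurable (F₁ ρ) μ := fun ρ =>
    (measurable_inner_gridComb L e _ h).aestronglyMeasurable
  have hm₂ : ∀ ρ, AEStronglyMeasurable (F₂ ρ) μ := fun ρ => by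
    simp only [hF₂, sum_inner, real_inner_smul_left]
    exact (Finset.measurable_sum _ fun ε _ =>
      (measurable_inner_gridComb L e _ h).const_mul _).aestronglyMeasurable
  have hdecomp : (fun x => inner ℝ (e (roundGrid (fun _ => L) x)) h) =
      ∑ ρ ∈ R, F₁ ρ + ∑ ρ ∈ R, F₂ ρ := by
    funext x
    rw [← gridComb_levelVec e x (l := fun _ => L) (L := L) (fun _ => by omega) fun _ => le_rfl,
      gridComb_levelVec_eq_sum L τ, ← hR, ← Finset.sum_add_distrib, Finset.sum_apply, sum_inner]
    exact Finset.sum_congr rfl fun ρ _ => inner_add_left _ _ _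
  have hb₁ : ∀ ρ ∈ R, eLpNorm (F₁ ρ) 2 μ ≤
      ENNReal.ofReal ((∏ j, B j) * ‖h‖ * (1 / 2) ^ (max (∑ i, ρ i) τ)) := fun ρ hρ =>
    eLpNorm_inner_gridComb_cons_sub_le he hB0 hB h (by omega) fun i =>
      Finset.mem_range.1 (Fintype.mem_piFinset.1 hρ i)
  have hb₂ : ∀ ρ ∈ R, eLpNorm (F₂ ρ) 2 μ ≤
      if ∑ i, ρ i < τ then 2 ^ D * ENNReal.ofReal q else 0 := fun ρ _ =>
    eLpNorm_inner_sum_gridComb_le e h hL ρ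
  have hs₁ : eLpNorm (∑ ρ ∈ R, F₁ ρ) 2 μ ≤
      ENNReal.ofReal ((∏ j, B j) * ‖h‖ * (2 ^ D * ((τ : ℝ) + 1) ^ D * (1 / 2) ^ τ)) := by
    refine (eLpNorm_sum_le (fun ρ _ => hm₁ ρ) one_le_two).trans
      ((Finset.sum_le_sum hb₁).trans ?_)
    rw [← ENNReal.ofReal_sum_of_nonneg fun _ _ => by positivity, ← Finset.mul_sum]
    refine ENNReal.ofReal_le_ofReal (mul_le_mul_of_nonneg_left ?_ (by positivity))
    exact sum_inv_two_pow_max_le D L τ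
  have hs₂ : eLpNorm (∑ ρ ∈ R, F₂ ρ) 2 μ ≤ ENNReal.ofReal ((τ : ℝ) ^ D * 2 ^ D * q) := by
    refine (eLpNorm_sum_le (fun ρ _ => hm₂ ρ) one_le_two).trans
      ((Finset.sum_le_sum hb₂).trans ?_)
    rw [← Finset.sum_filter, Finset.sum_const, nsmul_eq_mul,
      ENNReal.ofReal_mul (by positivity), ENNReal.ofReal_mul (by positivity), mul_assoc]
    refine mul_le_mul' ?_ (le_of_eq ?_)
    · rw [← Nat.cast_pow, ENNReal.ofReal_natCast]
      exact_mod_cast card_filter_sum_lt_le D L τ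
    · rw [ENNReal.ofReal_pow two_pos.le]
      simp
  rw [hdecomp, ENNReal.ofReal_add (by positivity) (by positivity)]
  exact (eLpNorm_add_le (Finset.aestronglyMeasurable_sum _ fun ρ _ => hm₁ ρ)
    (Finset.aestronglyMeasurable_sum _ fun ρ _ => hm₂ ρ) one_le_two).trans (add_le_add hs₁ hs₂)

theorem tendsto_roundGrid {x : Fin (D + 1) → ℝ} (hx : x ∈ unitCube (D + 1)) :
    Filter.Tendsto (fun L : ℕ => roundGrid (fun _ => L + 1) x) Filter.atTop
      (nhdsWithin x (unitCube (D + 1))) := by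
  refine tendsto_nhdsWithin_iff.2 ⟨tendsto_pi_nhds.2 fun j => ?_, .of_forall fun L => ?_⟩
  · rw [tendsto_iff_norm_sub_tendsto_zero]
    have h1 : Filter.Tendsto (fun L : ℕ => (1 / 2 : ℝ) ^ (L + 1)) Filter.atTop (nhds 0) :=
      (tendsto_pow_atTop_nhds_zero_of_lt_one (by norm_num) (by norm_num)).comp
        (Filter.tendsto_add_atTop_nat 1)
    refine squeeze_zero (fun _ => norm_nonneg _) (fun L => ?_) h1
    rw [Real.norm_eq_abs, abs_sub_comm, one_div_pow]
    exact abs_sub_roundDyadic_le _ (hx j).1.le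
  · intro j
    exact dyadicGrid_subset _ (roundDyadic_mem_dyadicGrid (Nat.succ_ne_zero L) (hx j).2)

/-- The bound for full-grid interpolants is uniform in `L`; continuity of `e` and lower
semicontinuity of the norm pass it to the limit. -/
theorem eLpNorm_inner_le
    (he : ∀ x y, inner ℝ (e x) (e y) = ∏ j, inner ℝ (e₁ j (x j)) (e₁ j (y j)))
    (hcont : ContinuousOn e (unitCube (D + 1)))
    {B : Fin (D + 1) → ℝ} (hB0 : ∀ j, 0 ≤ B j)
    (hB : ∀ j (h : E j) (n m L : ℕ), n ≤ m → m ≤ L →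
      ∑ c ∈ Finset.range (2 ^ L),
        (levelEval m (fun x => inner ℝ (e₁ j x) h) ((c : ℝ) / 2 ^ L) -
          levelEval n (fun x => inner ℝ (e₁ j x) h) ((c : ℝ) / 2 ^ L)) ^ 2
        ≤ 2 ^ L * (((1 / 2 ^ n) * B j) ^ 2 * ‖h‖ ^ 2))
    (h : H) {τ : ℕ} (hτ : 1 ≤ τ) :
    eLpNorm (fun x => inner ℝ (e x) h) 2 (volume.restrict (unitCube (D + 1))) ≤
      ENNReal.ofReal ((∏ j, B j) * ‖h‖ * (2 ^ D * ((τ : ℝ) + 1) ^ D * (1 / 2) ^ τ) +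
        (τ : ℝ) ^ D * 2 ^ D * √(2 ^ (D + 1) * (1 / 2) ^ τ *
          ∑ y ∈ sparseGrid (D + 1) τ, inner ℝ (e y) h ^ 2)) := by
  have hg : ContinuousOn (fun x => inner ℝ (e x) h) (unitCube (D + 1)) :=
    hcont.inner continuousOn_const
  refine (Lp.eLpNorm_lim_le_liminf_eLpNorm
    (f := fun L x => inner ℝ (e (roundGrid (fun _ => L + 1) x)) h) (fun L => ?_) _ ?_).trans ?_
  · have := measurable_inner_gridComb (L + 1) e (fun _ => levelVec (L + 1)) h
    simp_rw [gridComb_levelVec e _ (l := fun _ : Fin (D + 1) => L + 1) (fun _ => L.succ_ne_zero)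
      fun _ => le_rfl] at this
    exact this.aestronglyMeasurable
  · filter_upwards [self_mem_ae_restrict measurableSet_unitCube] with x hx
    exact (hg x hx).tendsto.comp (tendsto_roundGrid hx)
  · refine Filter.liminf_le_of_frequently_le' (Filter.Eventually.frequently ?_)
    filter_upwards [Filter.eventually_ge_atTop (τ + D)] with L hL
    exact eLpNorm_inner_roundGrid_le he hB0 hB h hτ (by omega)

end Estimate

/-! ### Converting the level into the sample size -/

section Rates

theorem natCast_le_mul_log {τ n : ℕ} (hn : 2 ≤ n) (h : 2 ^ τ - 1 ≤ n) :
    (τ : ℝ) ≤ 2 / Real.log 2 * Real.log n := by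
  have hlog2 : 0 < Real.log 2 := Real.log_pos one_lt_two
  have h1 : 2 ^ τ ≤ n ^ 2 := by
    have : n + 1 ≤ n ^ 2 := by nlinarith
    omega
  have h2 : ((2 : ℝ) ^ τ) ≤ (n : ℝ) ^ 2 := by exact_mod_cast h1
  have h3 := Real.log_le_log (by positivity) h2
  rw [Real.log_pow, Real.log_pow] at h3
  rw [div_mul_eq_mul_div, le_div_iff₀ hlog2]
  exact_mod_cast h3

theorem approximation_rate_le (D : ℕ) {τ n : ℕ} (hτ : 1 ≤ τ) (hn : 2 ≤ n) (h₁ : 2 ^ τ - 1 ≤ n)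
    {K : ℝ} (hK : 0 ≤ K) (h₂ : (n : ℝ) ≤ K * (τ ^ D * 2 ^ τ)) :
    2 ^ D * ((τ : ℝ) + 1) ^ D * (1 / 2) ^ τ ≤
      4 ^ D * K * (2 / Real.log 2) ^ (2 * D) * ((n : ℝ)⁻¹ * Real.log n ^ (2 * D)) := by
  have hn0 : (0 : ℝ) < n := by positivity
  have hτ1 : (1 : ℝ) ≤ τ := by exact_mod_cast hτ
  have h3 : (1 / 2 : ℝ) ^ τ ≤ K * τ ^ D * (n : ℝ)⁻¹ := by
    rw [one_div_pow, ← div_eq_mul_inv, div_le_div_iff₀ (by positivity) hn0]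
    linarith
  have h4 : ((τ : ℝ) + 1) ^ D ≤ 2 ^ D * τ ^ D := by
    rw [← mul_pow]
    gcongr
    linarith
  have h5 : (τ : ℝ) ^ (2 * D) ≤ (2 / Real.log 2) ^ (2 * D) * Real.log n ^ (2 * D) := by
    rw [← mul_pow]
    gcongr
    exact natCast_le_mul_log hn h₁
  calc 2 ^ D * ((τ : ℝ) + 1) ^ D * (1 / 2) ^ τ
      ≤ 2 ^ D * (2 ^ D * τ ^ D) * (K * τ ^ D * (n : ℝ)⁻¹) := by gcongr
    _ = (2 * 2) ^ D * K * (n : ℝ)⁻¹ * τ ^ (2 * D) := by rw [mul_pow, pow_mul', sq]; ring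
    _ ≤ (2 * 2) ^ D * K * (n : ℝ)⁻¹ * ((2 / Real.log 2) ^ (2 * D) * Real.log n ^ (2 * D)) := by
        gcongr
    _ = _ := by norm_num; ring

/-- One factor `τ^D` counts the sampled terms; a further `τ^{D/2}` comes from `n 2^{-τ} ≲ τ^D` under
the root, whence the exponent `3D/2`. -/
theorem stability_rate_le (D : ℕ) {τ n : ℕ} (hn : 2 ≤ n) (h₁ : 2 ^ τ - 1 ≤ n) {K : ℝ}
    (hK : 0 ≤ K) (h₂ : (n : ℝ) ≤ K * (τ ^ D * 2 ^ τ)) {Q N : ℝ} (hN : 0 ≤ N)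
    (hQ : Q ≤ n * N ^ 2) :
    (τ : ℝ) ^ D * 2 ^ D * √(2 ^ (D + 1) * (1 / 2) ^ τ * Q) ≤
      2 ^ D * √(2 ^ (D + 1) * K * (2 / Real.log 2) ^ (3 * D)) * (√(Real.log n ^ (3 * D)) * N) := by
  have hlog : 0 ≤ Real.log n := Real.log_natCast_nonneg n
  have hlog2 : 0 < Real.log 2 := Real.log_pos one_lt_two
  have h3 : (1 / 2 : ℝ) ^ τ * Q ≤ K * τ ^ D * N ^ 2 := by
    calc (1 / 2 : ℝ) ^ τ * Q ≤ (1 / 2 : ℝ) ^ τ * (K * (τ ^ D * 2 ^ τ) * N ^ 2) := by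
          gcongr
          exact hQ.trans (by gcongr)
      _ = ((1 / 2 : ℝ) ^ τ * 2 ^ τ) * (K * τ ^ D * N ^ 2) := by ring
      _ = _ := by rw [← mul_pow]; norm_num
  have h4 : (τ : ℝ) ^ (3 * D) ≤ (2 / Real.log 2) ^ (3 * D) * Real.log n ^ (3 * D) := by
    rw [← mul_pow]
    gcongr
    exact natCast_le_mul_log hn h₁
  have h5 : (τ : ℝ) ^ D = √(τ ^ (2 * D)) := by
    rw [mul_comm, pow_mul, Real.sqrt_sq (by positivity)]
  calc (τ : ℝ) ^ D * 2 ^ D * √(2 ^ (D + 1) * (1 / 2) ^ τ * Q)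
      = 2 ^ D * (√(τ ^ (2 * D)) * √(2 ^ (D + 1) * ((1 / 2) ^ τ * Q))) := by
        rw [← h5, mul_assoc (2 ^ (D + 1) : ℝ)]
        ring
    _ ≤ 2 ^ D * (√(τ ^ (2 * D)) * √(2 ^ (D + 1) * (K * τ ^ D * N ^ 2))) := by gcongr
    _ = 2 ^ D * √(2 ^ (D + 1) * K * N ^ 2 * τ ^ (3 * D)) := by
        rw [← Real.sqrt_mul (by positivity)]
        congr 2
        ring
    _ ≤ 2 ^ D * √(2 ^ (D + 1) * K * N ^ 2 *
          ((2 / Real.log 2) ^ (3 * D) * Real.log n ^ (3 * D))) := by gcongr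
    _ = 2 ^ D * √(2 ^ (D + 1) * K * (2 / Real.log 2) ^ (3 * D) *
          (Real.log n ^ (3 * D) * N ^ 2)) := by
        congr 2
        ring
    _ = _ := by
        rw [Real.sqrt_mul (x := 2 ^ (D + 1) * K * (2 / Real.log 2) ^ (3 * D)) (by positivity),
          Real.sqrt_mul (x := Real.log n ^ (3 * D)) (by positivity), Real.sqrt_sq hN]
        ring

end Rates

/-! ### Passing to the design points and the restricted norm -/

section Design

theorem sum_sparseGrid_sq_le {d n τ : ℕ} (hn : n ≠ 0) {x : Fin n → Fin d → ℝ}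
    (hx : ∀ y ∈ sparseGrid d τ, ∃ i, x i = y) (f : (Fin d → ℝ) → ℝ) :
    ∑ y ∈ sparseGrid d τ, f y ^ 2 ≤ n * empiricalNorm x f ^ 2 := by
  classical
  have hs : 0 ≤ ∑ i, f (x i) ^ 2 := Finset.sum_nonneg fun _ _ => sq_nonneg _
  have hn0 : (n : ℝ) ≠ 0 := by exact_mod_cast hn
  rw [empiricalNorm, Real.sq_sqrt (by positivity), ← mul_assoc, mul_one_div_cancel hn0, one_mul]
  calc ∑ y ∈ sparseGrid d τ, f y ^ 2 ≤ ∑ y ∈ Finset.univ.image x, f y ^ 2 := by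
        refine Finset.sum_le_sum_of_subset_of_nonneg (fun y hy => ?_) fun _ _ _ => sq_nonneg _
        obtain ⟨i, rfl⟩ := hx y hy
        exact Finset.mem_image_of_mem x (Finset.mem_univ i)
    _ ≤ _ := Finset.sum_image_le_of_nonneg fun _ _ => sq_nonneg _

theorem sparseGrid_subset_unitCube (d τ : ℕ) {y : Fin d → ℝ} (hy : y ∈ sparseGrid d τ) :
    y ∈ unitCube d := by
  rw [sparseGrid, Finset.mem_biUnion] at hy
  obtain ⟨l, -, hy⟩ := hy
  exact fun j => dyadicGrid_subset (l j) (Fintype.mem_piFinset.1 hy j)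

theorem TMKernel.Regular.eLpNorm_le {D : ℕ} {T : TMKernel (D + 1)} (hT : T.Regular) :
    ∃ P : ℝ, 0 ≤ P ∧ ∀ (f : (Fin (D + 1) → ℝ) → ℝ), ∀ h ∈ extensions T.kernel (unitCube (D + 1)) f,
      ∀ τ : ℕ, 1 ≤ τ →
      MemLp f 2 (volume.restrict (unitCube (D + 1))) ∧
      (eLpNorm f 2 (volume.restrict (unitCube (D + 1)))).toReal ≤
        P * ‖h‖ * (2 ^ D * ((τ : ℝ) + 1) ^ D * (1 / 2) ^ τ) +
        (τ : ℝ) ^ D * 2 ^ D * √(2 ^ (D + 1) * (1 / 2) ^ τ *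
          ∑ y ∈ sparseGrid (D + 1) τ, f y ^ 2) := by
  choose B hB0 hB using fun j => hT.exists_sum_levelEval_sub_sq_le j
  refine ⟨∏ j, B j, Finset.prod_nonneg fun j _ => hB0 j, fun f h hh τ hτ => ?_⟩
  have heq : ∀ x ∈ unitCube (D + 1), inner ℝ (kernelSection T.kernel x) h = f x := by
    intro x hx
    rw [inner_kernelSection T.kernel (hT.unitCube_subset_box hx)]
    exact hh ⟨x, hT.unitCube_subset_box hx⟩ hx
  have hae : (fun x => inner ℝ (kernelSection T.kernel x) h) =ᵐ[volume.restrict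
      (unitCube (D + 1))] f := by
    filter_upwards [self_mem_ae_restrict measurableSet_unitCube] with x hx
    exact heq x hx
  have hmeas : AEStronglyMeasurable f (volume.restrict (unitCube (D + 1))) :=
    ((hT.continuousOn_kernelSection.inner continuousOn_const).aestronglyMeasurable
      measurableSet_unitCube).congr hae
  have key := eLpNorm_inner_le T.inner_kernelSection_eq_prod hT.continuousOn_kernelSection hB0 hB
    h hτ
  rw [eLpNorm_congr_ae hae, Finset.sum_congr rfl fun y hy => by
    rw [heq y (sparseGrid_subset_unitCube _ τ hy)]] at key
  refine ⟨⟨hmeas, key.trans_lt ENNReal.ofReal_lt_top⟩, ?_⟩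
  refine ENNReal.toReal_le_of_le_ofReal ?_ key
  have := Finset.prod_nonneg fun j (_ : j ∈ Finset.univ) => hB0 j
  positivity

end Design

end SparseGrid

end

theorem mainTheorem9 (d : ℕ) (hd : 1 ≤ d) (T : SparseGrid.TMKernel d) (hT : T.Regular) :
    ∃ C : ℝ, 0 < C ∧
      ∀ n : ℕ, 2 ≤ n →
      ∀ x : Fin n → Fin d → ℝ,
        SparseGrid.FormTruncatedSparseGrid x →
      ∀ f : (Fin d → ℝ) → ℝ, T.Mem f →
        MemLp f 2 (volume.restrict (SparseGrid.unitCube d)) ∧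
        (eLpNorm f 2 (volume.restrict (SparseGrid.unitCube d))).toReal ≤
          C * (Real.log n ^ (3 * ((d : ℝ) - 1) / 2) * SparseGrid.empiricalNorm x f +
            (n : ℝ)⁻¹ * Real.log n ^ (2 * ((d : ℝ) - 1)) * T.norm f) := by
  obtain ⟨D, rfl⟩ : ∃ D, d = D + 1 := ⟨d - 1, by omega⟩
  obtain ⟨P, hP, hbound⟩ := hT.eLpNorm_le
  set K : ℝ := (D + 2 : ℝ) ^ D * 2 ^ (D + 2) with hK
  have hlog2 : 0 < Real.log 2 := Real.log_pos one_lt_two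
  set C₁ : ℝ := P * (4 ^ D * K * (2 / Real.log 2) ^ (2 * D)) with hC₁
  set C₂ : ℝ := 2 ^ D * √(2 ^ (D + 1) * K * (2 / Real.log 2) ^ (3 * D)) with hC₂
  have hC₁0 : 0 ≤ C₁ := by positivity
  have hC₂0 : 0 ≤ C₂ := by positivity
  -- The summand `1` makes the constant strictly positive, also when `P = 0`.
  refine ⟨C₁ + C₂ + 1, by positivity, fun n hn x hx f hf => ?_⟩
  obtain ⟨τ, hτ, hcard, hcard', A, -, -, hS⟩ := hx
  have hn0 : (0 : ℝ) < n := by positivity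
  have hlog : 0 < Real.log n := Real.log_pos (by exact_mod_cast hn)
  have h₁ : 2 ^ τ - 1 ≤ n := (SparseGrid.two_pow_le_card_sparseGrid D hτ).trans hcard
  have h₂ : (n : ℝ) ≤ K * (τ ^ D * 2 ^ τ) := by
    rw [hK]
    exact_mod_cast hcard'.le.trans (SparseGrid.card_sparseGrid_succ_le D hτ)
  have hmem : ∀ y ∈ SparseGrid.sparseGrid (D + 1) τ, ∃ i, x i = y := by
    intro y hy
    have h3 := Finset.mem_union_left A hy
    rw [← hS, Finset.mem_image] at h3
    obtain ⟨i, -, hi⟩ := h3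
    exact ⟨i, hi⟩
  set N := SparseGrid.empiricalNorm x f with hN
  have hN0 : 0 ≤ N := Real.sqrt_nonneg _
  have hQ := SparseGrid.sum_sparseGrid_sq_le (by omega) hmem f
  have hpow₁ : Real.log n ^ (3 * (((D + 1 : ℕ) : ℝ) - 1) / 2) = √(Real.log n ^ (3 * D)) := by
    rw [Real.sqrt_eq_rpow, ← Real.rpow_natCast, ← Real.rpow_mul hlog.le]
    congr 1
    push_cast
    ring
  have hpow₂ : Real.log n ^ (2 * (((D + 1 : ℕ) : ℝ) - 1)) = Real.log n ^ (2 * D) := by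
    rw [← Real.rpow_natCast]
    congr 1
    push_cast
    ring
  rw [hpow₁, hpow₂]
  refine ⟨(hbound f hf.some hf.some_mem τ hτ).1, ?_⟩
  set Λ₁ := √(Real.log n ^ (3 * D)) with hΛ₁
  set Λ₂ := (n : ℝ)⁻¹ * Real.log n ^ (2 * D) with hΛ₂
  have hΛ₁0 : 0 ≤ Λ₁ := Real.sqrt_nonneg _
  have hΛ₂0 : 0 < Λ₂ := by positivity
  have hC0 : 0 < C₁ + C₂ + 1 := by positivity
  -- The estimate is solved for `‖h‖`, so that it passes to the infimum over extensions without any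
  -- claim that the infimum is attained.
  have hall : ∀ h ∈ SparseGrid.extensions T.kernel (SparseGrid.unitCube (D + 1)) f,
      ((eLpNorm f 2 (volume.restrict (SparseGrid.unitCube (D + 1)))).toReal / (C₁ + C₂ + 1) -
        Λ₁ * N) / Λ₂ ≤ ‖h‖ := by
    intro h hh
    rw [div_le_iff₀ hΛ₂0, sub_le_iff_le_add, div_le_iff₀ hC0]
    refine (hbound f h hh τ hτ).2.trans ?_
    have ha := mul_le_mul_of_nonneg_left
      (SparseGrid.approximation_rate_le D hτ hn h₁ (by positivity) h₂)
      (mul_nonneg hP (norm_nonneg h))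
    have hs := SparseGrid.stability_rate_le D hn h₁ (by positivity) h₂ hN0 hQ
    have hb₁ : 0 ≤ ‖h‖ * Λ₂ := by positivity
    have hb₂ : 0 ≤ Λ₁ * N := by positivity
    calc _ ≤ C₁ * (‖h‖ * Λ₂) + C₂ * (Λ₁ * N) := by
          refine add_le_add (ha.trans (le_of_eq ?_)) hs
          rw [hC₁]
          ring
      _ ≤ (‖h‖ * Λ₂ + Λ₁ * N) * (C₁ + C₂ + 1) := by
          have h4 : 0 ≤ C₂ * (‖h‖ * Λ₂) := by positivity
          have h5 : 0 ≤ C₁ * (Λ₁ * N) := by positivity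
          linarith
  have hinf : ((eLpNorm f 2 (volume.restrict (SparseGrid.unitCube (D + 1)))).toReal /
      (C₁ + C₂ + 1) - Λ₁ * N) / Λ₂ ≤ T.norm f := by
    refine le_csInf (hf.image _) ?_
    rintro _ ⟨h, hh, rfl⟩
    exact hall h hh
  rw [div_le_iff₀ hΛ₂0, sub_le_iff_le_add, div_le_iff₀ hC0] at hinf
  linarith
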